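/- **Theorem 4.4.** A *dissociation set* of a graph is a set of vertices inducing a subgraph in which every vertex has degree at most $1$; it is *maximum* if it has maximum cardinality among all dissociation sets. A *leaf* is a vertex of degree $1$, and $P_k$ is the path on $k$ vertices. For trees $T_1,\dots,T_r$, let $S^*_{T_1,\dots,T_r}$ denote any tree consisting of $r$ induced subtrees isomorphic to $T_1,\dots,T_r$ that all contain one vertex $v$, which is a leaf of each of them, and that pairwise share no vertex other than $v$. Let $LT_8$ be the tree on the $8$ vertices $u_1,\dots,u_4,v_1,\dots,v_4$ with edges $u_1u_2,\ u_2u_3,\ u_3u_4$ and $u_iv_i$ for $1\le i\le 4$. Let $m$ be a positive integer. Every tree on $3m+2$ vertices has at most $3^{m-1}$ maximum dissociation sets, and some tree on $3m+2$ vertices has exactly $3^{m-1}$ of them. Moreover, for a tree $T$ on $3m+2$ vertices: 1. if $m\ne 2$, then $T$ has exactly $3^{m-1}$ maximum dissociation sets if and only if $T$ is an $S^*_{P_3,P_3,T_1,\dots,T_{m-1}}$, an $S^*_{P_2,P_2,P_2,P_2,T_1,\dots,T_{m-1}}$ or an $S^*_{P_3,P_2,P_2,T_1,\dots,T_{m-1}}$,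 where each $T_i$ ($1\le i\le m-1$) is isomorphic to $P_4$ or to $K_{1,3}$; 2. if $m=2$, then $T$ has exactly $3^{m-1}=3$ maximum dissociation sets if and only if $T\cong LT_8$ or $T$ is an $S^*_{P_3,P_3,T_1}$, an $S^*_{P_2,P_2,P_2,P_2,T_1}$ or an $S^*_{P_3,P_2,P_2,T_1}$, where $T_1$ is isomorphic to $P_4$ or to $K_{1,3}$. -/

import Mathlib

/-- `S` is a dissociation set of `G`: every vertex of the subgraph induced by `S` has degree at
most one in that subgraph. -/
def IsDissociationSet {V : Type*} (G : SimpleGraph V) (S : Finset V) : Prop :=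
  ∀ v : (S : Set V), ((G.induce (S : Set V)).neighborSet v).encard ≤ 1

/-- A dissociation set of maximum cardinality. -/
def IsMaximumDissociationSet {V : Type*} (G : SimpleGraph V) (S : Finset V) : Prop :=
  IsDissociationSet G S ∧ ∀ S' : Finset V, IsDissociationSet G S' → S'.card ≤ S.card

/-- The number of maximum dissociation sets of a graph on a finite vertex type. -/
noncomputable def numMaximumDissociationSets {V : Type*} [Finite V] (G : SimpleGraph V) : ℕ :=
  {S : Finset V | IsMaximumDissociationSet G S}.ncard

/-- A graph on the vertex set `{0, …, n - 1}`, for some `n`. -/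
abbrev FinGraph : Type := Σ n : ℕ, SimpleGraph (Fin n)

/-- The path `P_n` on `n` vertices. -/
def pathFinGraph (n : ℕ) : FinGraph := ⟨n, SimpleGraph.pathGraph n⟩

/-- `v` is a leaf of `G`: it has exactly one neighbor. -/
def IsLeaf {V : Type*} (G : SimpleGraph V) (v : V) : Prop :=
  (G.neighborSet v).encard = 1

/-- `G` is a graph `S^*_{T_1, …, T_r}`: it consists of induced subgraphs isomorphic to the
`T i`, glued at one vertex `v` which is a leaf of each of them; the subgraphs share no other vertex,
and together they contain all vertices and all edges of `G`. -/
def IsSStar {V ι : Type*} (G : SimpleGraph V) (T : ι → FinGraph) : Prop :=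
  ∃ (v : V) (W : ι → Set V) (hv : ∀ i, v ∈ W i),
    (∀ i, Nonempty (G.induce (W i) ≃g (T i).2)) ∧
    (∀ i, IsLeaf (G.induce (W i)) ⟨v, hv i⟩) ∧
    (∀ i j, i ≠ j → W i ∩ W j = {v}) ∧
    (⋃ i, W i) = Set.univ ∧
    (∀ x y, G.Adj x y → ∃ i, x ∈ W i ∧ y ∈ W i)

/-- `T ≅ P_4` or `T ≅ K_{1,3}`. -/
def IsP4OrK13 (T : FinGraph) : Prop :=
  Nonempty (T.2 ≃g SimpleGraph.pathGraph 4) ∨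
    Nonempty (T.2 ≃g completeBipartiteGraph (Fin 1) (Fin 3))

/-- `G` belongs to the family `S^*_{A_1, …, A_a, T_1, …, T_k}` in which every `T_i` is isomorphic
to `P_4` or to `K_{1,3}`. -/
def InSStarFamily {V : Type*} (G : SimpleGraph V) {a : ℕ} (A : Fin a → FinGraph) (k : ℕ) : Prop :=
  ∃ T : Fin k → FinGraph, (∀ i, IsP4OrK13 (T i)) ∧ IsSStar G (Sum.elim A T)

/-- The tree `LT_8`: the path `u_1 u_2 u_3 u_4` on the vertices `0, 1, 2, 3`, with one pendant
vertex `v_i` attached to each `u_i`; the `v_i` are the vertices `4, 5, 6, 7`. -/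
def LT8 : SimpleGraph (Fin 8) :=
  SimpleGraph.fromEdgeSet
    {s(0, 1), s(1, 2), s(2, 3), s(0, 4), s(1, 5), s(2, 6), s(3, 7)}

/-- `G` belongs to one of the three families `S^*_{P_3, P_3, T_1, …, T_k}`,
`S^*_{P_2, P_2, P_2, P_2, T_1, …, T_k}`, `S^*_{P_3, P_2, P_2, T_1, …, T_k}`,
each `T_i` being isomorphic to `P_4` or to `K_{1,3}`. -/
def InExtremalSStarFamilies {V : Type*} (G : SimpleGraph V) (k : ℕ) : Prop :=
  InSStarFamily G ![pathFinGraph 3, pathFinGraph 3] k ∨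
  InSStarFamily G ![pathFinGraph 2, pathFinGraph 2, pathFinGraph 2, pathFinGraph 2] k ∨
  InSStarFamily G ![pathFinGraph 3, pathFinGraph 2, pathFinGraph 2] k

/-! Complements of dissociation sets are the sets meeting every path on three vertices, so the
maximum dissociation sets correspond to the minimum path covers. In a tree the least size `t` of a
cover equals the largest number of disjoint three-vertex paths (`IsBranch.hasRootedDuality`). Fix
`t` such paths: every cover meets each of them, so a minimum cover picks exactly one vertex from
each, and the task is to count the words in `ι → Fin 3` whose transversal is a cover
(`coveringChoices`).

On `3 m + 2` vertices, `t ≤ m`. If `t < m`, a vertex outside the paths but adjacent to one of them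
leaves only two values for one coordinate, so there are at most `2 * 3 ^ (t - 1) < 3 ^ (m - 1)`
words (`t = 0` is impossible, as the empty set would be a cover). If `t = m`, exactly two vertices
`w₁`, `w₂` lie outside.

Suppose first that some coordinate is constant on the covering words. The bound is immediate, and
equality means that all words with that value cover. The chosen vertex `v` then separates all the
other paths from each other and from the four remaining vertices, which induce a matching; this is
the structure of the `S^*` families (`IsPathFamily.nonempty_iso_starTree_of_forced`).

Otherwise `w₁`, `w₂` are attached to ends of two different paths, and each halves to two values the
choice on its path. A third path near them cuts the allowed triples of values to at most 8 of the
27, fewer than the 9 needed. Without a third path, `m = 2` and an edge joins the two paths; it rules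
out at least one of the four pairs left, and exactly one only in `LT8`
(`IsPathFamily.card_coveringChoices_le`).

Conversely, in the extremal trees a transversal covers if and only if it contains the centre, and
`LT8` is counted directly. -/

/-! ### Dissociation sets as complements of path covers -/

/-- `C` meets every path on three vertices of `G`. -/
def IsPathCover {V : Type*} (G : SimpleGraph V) (C : Finset V) : Prop :=
  ∀ a b c, G.Adj a b → G.Adj b c → a ≠ c → a ∈ C ∨ b ∈ C ∨ c ∈ C

theorem isDissociationSet_iff {V : Type*} {G : SimpleGraph V} {S : Finset V} :
    IsDissociationSet G S ↔
      ∀ a b c, G.Adj a b → G.Adj b c → a ≠ c → a ∈ S → b ∈ S → c ∈ S → False := by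
  constructor
  · intro h a b c hab hbc hac ha hb hc
    have := Set.encard_le_one_iff.1 (h ⟨b, hb⟩) ⟨a, ha⟩ ⟨c, hc⟩ (by simpa using hab.symm)
      (by simpa using hbc)
    exact hac (congrArg Subtype.val this)
  · rintro h ⟨b, hb⟩
    rw [Set.encard_le_one_iff]
    rintro ⟨a, ha⟩ ⟨c, hc⟩ hab hbc
    by_contra hne
    simp only [SimpleGraph.mem_neighborSet, SimpleGraph.comap_adj,
      Function.Embedding.subtype_apply] at hab hbc
    exact h a b c hab.symm hbc (fun h => hne (Subtype.ext h)) ha hb hc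

theorem isDissociationSet_compl_iff {V : Type*} [Fintype V] [DecidableEq V]
    {G : SimpleGraph V} {C : Finset V} : IsDissociationSet G Cᶜ ↔ IsPathCover G C := by
  rw [isDissociationSet_iff]
  unfold IsPathCover
  simp only [Finset.mem_compl]
  refine forall₃_congr fun a b c => ?_
  tauto

/-- Counting maximum dissociation sets is counting minimum path covers. -/
theorem numMaximumDissociationSets_eq {V : Type*} [Fintype V] (G : SimpleGraph V) (t : ℕ)
    (hex : ∃ C : Finset V, IsPathCover G C ∧ C.card = t)
    (hmin : ∀ C : Finset V, IsPathCover G C → t ≤ C.card) :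
    numMaximumDissociationSets G = {C : Finset V | IsPathCover G C ∧ C.card = t}.ncard := by
  classical
  unfold numMaximumDissociationSets
  obtain ⟨C₀, h₀, hc₀⟩ := hex
  have key : {S : Finset V | IsMaximumDissociationSet G S} =
      compl '' {C : Finset V | IsPathCover G C ∧ C.card = t} := by
    ext S
    simp only [Set.mem_ofPred_eq, Set.mem_image]
    constructor
    · rintro ⟨hS, hmax⟩
      refine ⟨Sᶜ, ⟨?_, ?_⟩, compl_compl S⟩
      · rw [← isDissociationSet_compl_iff, compl_compl]; exact hS
      · have h1 := hmax C₀ᶜ (isDissociationSet_compl_iff.2 h₀)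
        have h2 := hmin Sᶜ (by rw [← isDissociationSet_compl_iff, compl_compl]; exact hS)
        rw [Finset.card_compl] at h1 h2 ⊢
        have := Finset.card_le_univ S
        have := Finset.card_le_univ C₀
        omega
    · rintro ⟨C, ⟨hC, hcard⟩, rfl⟩
      refine ⟨isDissociationSet_compl_iff.2 hC, fun S' hS' => ?_⟩
      have h2 := hmin S'ᶜ (by rw [← isDissociationSet_compl_iff, compl_compl]; exact hS')
      rw [Finset.card_compl] at h2 ⊢
      have := Finset.card_le_univ S'
      omega
  rw [key, Set.ncard_image_of_injective _ compl_injective]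

theorem numMaximumDissociationSets_congr {V W : Type*} [Finite V] [Finite W] {G : SimpleGraph V}
    {H : SimpleGraph W} (φ : G ≃g H) :
    numMaximumDissociationSets G = numMaximumDissociationSets H := by
  classical
  have hd : ∀ S : Finset V, IsDissociationSet H (S.map φ.toEquiv.toEmbedding) ↔
      IsDissociationSet G S := by
    intro S
    rw [isDissociationSet_iff, isDissociationSet_iff]
    constructor
    · intro h a b c hab hbc hac ha hb hc
      exact h (φ a) (φ b) (φ c) (φ.map_adj_iff.2 hab) (φ.map_adj_iff.2 hbc)
        (fun h => hac (φ.injective h)) (Finset.mem_map_of_mem _ ha) (Finset.mem_map_of_mem _ hb)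
        (Finset.mem_map_of_mem _ hc)
    · intro h a b c hab hbc hac ha hb hc
      obtain ⟨a, rfl⟩ := φ.surjective a
      obtain ⟨b, rfl⟩ := φ.surjective b
      obtain ⟨c, rfl⟩ := φ.surjective c
      exact h a b c (φ.map_adj_iff.1 hab) (φ.map_adj_iff.1 hbc)
        (fun h => hac (congrArg φ h)) ((Finset.mem_map' _).1 ha) ((Finset.mem_map' _).1 hb)
        ((Finset.mem_map' _).1 hc)
  have hm : ∀ T : Finset W, ∃ S : Finset V, S.map φ.toEquiv.toEmbedding = T := fun T =>
    ⟨T.map φ.toEquiv.symm.toEmbedding, by ext; simp⟩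
  unfold numMaximumDissociationSets
  rw [← Set.ncard_image_of_injective _ (Finset.map_injective φ.toEquiv.toEmbedding)]
  congr 1
  ext T
  obtain ⟨S, rfl⟩ := hm T
  rw [(Finset.map_injective _).mem_set_image]
  constructor
  · rintro ⟨h1, h2⟩
    refine ⟨(hd S).2 h1, fun T' hT' => ?_⟩
    obtain ⟨S', rfl⟩ := hm T'
    simpa using h2 S' ((hd S').1 hT')
  · rintro ⟨h1, h2⟩
    exact ⟨(hd S).1 h1, fun S' hS' => by simpa using h2 _ ((hd S').2 hS')⟩

/-! ### Trees and their rooted decompositions -/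

/-- A proper nonempty vertex set of a connected graph has an edge leaving it. -/
theorem SimpleGraph.Connected.exists_adj_mem_notMem {V : Type*} {G : SimpleGraph V}
    (hG : G.Connected) (S : Set V) {a b : V} (ha : a ∈ S) (hb : b ∉ S) :
    ∃ x ∈ S, ∃ y ∉ S, G.Adj x y := by
  obtain ⟨p⟩ := hG.preconnected a b
  obtain ⟨d, -, h1, h2⟩ := p.exists_boundary_dart S ha hb
  exact ⟨d.fst, h1, d.snd, h2, d.adj⟩

/-- A bijective homomorphism between finite trees is an isomorphism. -/
theorem SimpleGraph.IsTree.nonempty_iso_of_bijective {V W : Type*} [Fintype V] [Fintype W]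
    {G : SimpleGraph V} {H : SimpleGraph W} (hG : G.IsTree) (hH : H.IsTree) (f : W → V)
    (hf : f.Bijective) (hadj : ∀ x y, H.Adj x y → G.Adj (f x) (f y)) : Nonempty (G ≃g H) := by
  classical
  let e := Equiv.ofBijective f hf
  have hsub : H.edgeFinset.image (Sym2.map f) ⊆ G.edgeFinset := by
    intro z hz
    obtain ⟨w, hw, rfl⟩ := Finset.mem_image.1 hz
    induction w with
    | _ x y => simpa using hadj x y (by simpa using hw)
  have hcard : (H.edgeFinset.image (Sym2.map f)).card = H.edgeFinset.card :=
    Finset.card_image_of_injective _ (Sym2.map.injective hf.1)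
  have h1 := hG.card_edgeFinset
  have h2 := hH.card_edgeFinset
  have h3 := Fintype.card_congr e
  have heq := Finset.eq_of_subset_of_card_le hsub (by omega)
  refine ⟨SimpleGraph.Iso.symm ⟨e, ?_⟩⟩
  intro x y
  refine ⟨fun h => ?_, hadj x y⟩
  have : s(f x, f y) ∈ G.edgeFinset := by rw [SimpleGraph.mem_edgeFinset]; exact h
  rw [← heq, Finset.mem_image] at this
  obtain ⟨w, hw, hwe⟩ := this
  have : w = s(x, y) := Sym2.map.injective hf.1 (by simpa using hwe)
  subst this
  simpa using hw

/-- `A` induces a subtree of `G` with root `r`, built by repeatedly joining two disjoint rooted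
subtrees by an edge between their roots. -/
inductive IsBranch {V : Type*} [DecidableEq V] (G : SimpleGraph V) : Finset V → V → Prop
  | single (r : V) : IsBranch G {r} r
  | join (A B : Finset V) (r s : V) : IsBranch G A r → IsBranch G B s → Disjoint A B →
      G.Adj r s → (∀ x ∈ A, ∀ y ∈ B, G.Adj x y → x = r ∧ y = s) → IsBranch G (A ∪ B) r

theorem IsBranch.root_mem {V : Type*} [DecidableEq V] {G : SimpleGraph V} {A : Finset V} {r : V}
    (h : IsBranch G A r) : r ∈ A := by
  induction h with
  | single r => simp
  | join A B r s _ _ _ _ _ ih _ => exact Finset.mem_union_left _ ih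

/-- Trees are dismantled leaf by leaf, while `join` glues at roots. The new leaf is pushed down to
the piece containing its neighbour `x`, until that piece is `{x}` and the leaf becomes a one-vertex
branch joined to it. -/
theorem IsBranch.insert_leaf {V : Type*} [DecidableEq V] {G : SimpleGraph V} {A : Finset V}
    {r : V} (h : IsBranch G A r) {l x : V} (hl : l ∉ A) (hx : x ∈ A) (hadj : G.Adj x l)
    (huniq : ∀ y ∈ A, G.Adj y l → y = x) : IsBranch G (insert l A) r := by
  induction h generalizing x with
  | single r =>
    obtain rfl := Finset.mem_singleton.1 hx
    rw [Finset.insert_eq, Finset.union_comm]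
    exact .join _ _ _ _ (.single x) (.single l) (by simpa using Ne.symm (by simpa using hl)) hadj
      (by simp)
  | join A B r s hA hB hd hrs hc ihA ihB =>
    rw [Finset.mem_union, not_or] at hl
    rcases Finset.mem_union.1 hx with hx | hx
    · rw [← Finset.insert_union]
      refine .join _ _ _ _ (ihA hl.1 hx hadj fun y hy => huniq y (Finset.mem_union_left _ hy)) hB
        (Finset.disjoint_insert_left.2 ⟨hl.2, hd⟩) hrs fun a ha b hb hab => ?_
      rcases Finset.mem_insert.1 ha with rfl | ha
      · obtain rfl := huniq b (Finset.mem_union_right _ hb) hab.symm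
        exact absurd hb (Finset.disjoint_left.1 hd hx)
      · exact hc a ha b hb hab
    · rw [← Finset.union_insert]
      refine .join _ _ _ _ hA (ihB hl.2 hx hadj fun y hy => huniq y (Finset.mem_union_right _ hy))
        (Finset.disjoint_insert_right.2 ⟨hl.1, hd⟩) hrs fun a ha b hb hab => ?_
      rcases Finset.mem_insert.1 hb with rfl | hb
      · obtain rfl := huniq a (Finset.mem_union_left _ ha) hab
        exact absurd hx (Finset.disjoint_left.1 hd ha)
      · exact hc a ha b hb hab

theorem IsBranch.map {V W : Type*} [DecidableEq V] [DecidableEq W] {G : SimpleGraph V}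
    {H : SimpleGraph W} (φ : H ↪g G) {A : Finset W} {r : W} (h : IsBranch H A r) :
    IsBranch G (A.map φ.toEmbedding) (φ r) := by
  induction h with
  | single r => simpa using IsBranch.single (G := G) (φ r)
  | join A B r s _ _ hd hrs hc ihA ihB =>
    rw [Finset.map_union]
    refine .join _ _ _ _ ihA ihB ((Finset.disjoint_map _).2 hd) (φ.map_adj_iff.2 hrs) ?_
    intro x hx y hy hxy
    obtain ⟨x, hx', rfl⟩ := Finset.mem_map.1 hx
    obtain ⟨y, hy', rfl⟩ := Finset.mem_map.1 hy
    obtain ⟨rfl, rfl⟩ := hc x hx' y hy' (φ.map_adj_iff.1 hxy)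
    exact ⟨rfl, rfl⟩

theorem SimpleGraph.IsTree.exists_isBranch {V : Type*} [Fintype V] [DecidableEq V]
    {G : SimpleGraph V} (hG : G.IsTree) : ∃ r, IsBranch G Finset.univ r := by
  classical
  induction hn : Fintype.card V generalizing V with
  | zero =>
    have := hG.1.nonempty
    exact absurd hn Fintype.card_ne_zero
  | succ n ih =>
    have := hG.1.nonempty
    rcases subsingleton_or_nontrivial V with hV | hV
    · obtain ⟨r⟩ := this
      refine ⟨r, ?_⟩
      rw [show (Finset.univ : Finset V) = {r} by ext x; simp [Subsingleton.elim x r]]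
      exact .single r
    · obtain ⟨l, hl⟩ := hG.exists_vert_degree_one_of_nontrivial
      have hT : (G.induce {l}ᶜ).IsTree :=
        ⟨hG.1.induce_compl_singleton_of_degree_eq_one hl, hG.2.induce _⟩
      obtain ⟨r, hr⟩ := ih hT (by
        rw [Fintype.card_compl_set]
        simp [hn])
      obtain ⟨x, hx, huniq⟩ := (SimpleGraph.degree_eq_one_iff_existsUnique_adj).1 hl
      have hb := hr.map (SimpleGraph.Embedding.induce _)
      have := hb.insert_leaf (l := l) (x := x) (by simp) (by simpa using hx.ne') hx.symm
        (fun y _ hy => huniq y hy.symm)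
      refine ⟨r.1, ?_⟩
      convert this using 1
      · ext y
        by_cases hy : y = l <;> simp [hy]
      · rfl

/-! ### Packing and covering three-vertex paths in trees -/

/-- `U` is the union of `t` disjoint paths on three vertices of `G`. -/
inductive IsPathPacking {V : Type*} [DecidableEq V] (G : SimpleGraph V) : Finset V → ℕ → Prop
  | empty : IsPathPacking G ∅ 0
  | add (U : Finset V) (t : ℕ) (a b c : V) : IsPathPacking G U t → G.Adj a b → G.Adj b c → a ≠ c →
      a ∉ U → b ∉ U → c ∉ U → IsPathPacking G (U ∪ {a, b, c}) (t + 1)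

theorem IsPathPacking.union {V : Type*} [DecidableEq V] {G : SimpleGraph V} {U U' : Finset V}
    {t t' : ℕ} (h : IsPathPacking G U t) (h' : IsPathPacking G U' t') (hd : Disjoint U U') :
    IsPathPacking G (U ∪ U') (t + t') := by
  induction h' with
  | empty => simpa using h
  | add U' t' a b c _ hab hbc hac ha hb hc ih =>
    rw [Finset.disjoint_union_right] at hd
    rw [← Finset.union_assoc, ← Nat.add_assoc]
    have h2 := Finset.disjoint_right.1 hd.2
    exact .add _ _ _ _ _ (ih hd.1) hab hbc hac
      (by simp [ha, h2 (a := a) (by simp)]) (by simp [hb, h2 (a := b) (by simp)])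
      (by simp [hc, h2 (a := c) (by simp)])

/-- A family of disjoint paths `q i 0, q i 1, q i 2`. -/
structure IsPathFamily {V ι : Type*} (G : SimpleGraph V) (q : ι → Fin 3 → V) : Prop where
  inj : ∀ i j i' j', q i j = q i' j' → i = i' ∧ j = j'
  adj01 : ∀ i, G.Adj (q i 0) (q i 1)
  adj12 : ∀ i, G.Adj (q i 1) (q i 2)

theorem IsPathPacking.exists_isPathFamily {V : Type*} [DecidableEq V] {G : SimpleGraph V}
    {U : Finset V} {t : ℕ} (h : IsPathPacking G U t) :
    ∃ q : Fin t → Fin 3 → V, IsPathFamily G q ∧ ∀ i j, q i j ∈ U := by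
  induction h with
  | empty => exact ⟨Fin.elim0, ⟨fun i => i.elim0, fun i => i.elim0, fun i => i.elim0⟩,
      fun i => i.elim0⟩
  | add U t a b c _ hab hbc hac ha hb hc ih =>
    obtain ⟨q, hq, hU⟩ := ih
    have hn : ∀ j, ![a, b, c] j ∉ U := by
      intro j; fin_cases j <;> simpa
    refine ⟨Fin.cons ![a, b, c] q, ⟨?_, ?_, ?_⟩, ?_⟩
    · intro i j i' j' h
      cases i using Fin.cases with
      | zero =>
        cases i' using Fin.cases with
        | zero =>
          refine ⟨rfl, ?_⟩
          simp only [Fin.cons_zero] at h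
          have h1 := hab.ne
          have h2 := hbc.ne
          fin_cases j <;> fin_cases j' <;> simp_all
        | succ i' =>
          simp only [Fin.cons_zero, Fin.cons_succ] at h
          exact absurd (h ▸ hU i' j') (hn j)
      | succ i =>
        cases i' using Fin.cases with
        | zero =>
          simp only [Fin.cons_zero, Fin.cons_succ] at h
          exact absurd (h ▸ hU i j) (hn j')
        | succ i' => simpa using hq.inj i j i' j' (by simpa using h)
    · intro i; cases i using Fin.cases with
      | zero => simpa
      | succ i => simpa using hq.adj01 i
    · intro i; cases i using Fin.cases with
      | zero => simpa
      | succ i => simpa using hq.adj12 i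
    · intro i j; cases i using Fin.cases with
      | zero => fin_cases j <;> simp
      | succ i => exact Finset.mem_union_left _ (by simpa using hU i j)

/-- A path cover of the subgraph on `A` together with a packing of equal size, and a description
of the uncovered component of the root `r`. -/
def HasRootedDuality {V : Type*} [DecidableEq V] (G : SimpleGraph V) (A : Finset V) (r : V) :
    Prop :=
  ∃ C U : Finset V, C ⊆ A ∧ U ⊆ A ∧ IsPathPacking G U C.card ∧
    (∀ a ∈ A, ∀ b ∈ A, ∀ c ∈ A, G.Adj a b → G.Adj b c → a ≠ c → a ∈ C ∨ b ∈ C ∨ c ∈ C) ∧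
    (r ∈ C ∨ (r ∉ U ∧ ∀ y ∈ A, G.Adj r y → y ∈ C) ∨
      ∃ r' ∈ A, G.Adj r r' ∧ r ∉ U ∧ r' ∉ U ∧ (∀ y ∈ A, G.Adj r y → y ∈ C ∨ y = r') ∧
        ∀ y ∈ A, G.Adj r' y → y ∈ C ∨ y = r)

theorem cover_mono {V : Type*} {G : SimpleGraph V} {A C D : Finset V} (hCD : C ⊆ D)
    (h : ∀ a ∈ A, ∀ b ∈ A, ∀ c ∈ A, G.Adj a b → G.Adj b c → a ≠ c → a ∈ C ∨ b ∈ C ∨ c ∈ C) :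
    ∀ a ∈ A, ∀ b ∈ A, ∀ c ∈ A, G.Adj a b → G.Adj b c → a ≠ c → a ∈ D ∨ b ∈ D ∨ c ∈ D :=
  fun a ha b hb c hc h1 h2 h3 =>
    (h a ha b hb c hc h1 h2 h3).imp (@hCD _) (Or.imp (@hCD _) (@hCD _))

/-- The only edge between `A` and `B` is `rs`, so a path meeting both sides consists of `r`, `s` and
one more neighbour of either. -/
theorem cover_union {V : Type*} [DecidableEq V] {G : SimpleGraph V} {A B C : Finset V} {r s : V}
    (hA : ∀ a ∈ A, ∀ b ∈ A, ∀ c ∈ A, G.Adj a b → G.Adj b c → a ≠ c → a ∈ C ∨ b ∈ C ∨ c ∈ C)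
    (hB : ∀ a ∈ B, ∀ b ∈ B, ∀ c ∈ B, G.Adj a b → G.Adj b c → a ≠ c → a ∈ C ∨ b ∈ C ∨ c ∈ C)
    (hc : ∀ x ∈ A, ∀ y ∈ B, G.Adj x y → x = r ∧ y = s)
    (hr : ∀ y ∈ A, G.Adj r y → r ∈ C ∨ s ∈ C ∨ y ∈ C)
    (hs : ∀ y ∈ B, G.Adj s y → r ∈ C ∨ s ∈ C ∨ y ∈ C) :
    ∀ a ∈ A ∪ B, ∀ b ∈ A ∪ B, ∀ c ∈ A ∪ B, G.Adj a b → G.Adj b c → a ≠ c →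
      a ∈ C ∨ b ∈ C ∨ c ∈ C := by
  intro a ha b hb c hcc hab hbc hac
  rcases Finset.mem_union.1 ha with ha | ha <;> rcases Finset.mem_union.1 hb with hb | hb <;>
    rcases Finset.mem_union.1 hcc with hcc | hcc
  · exact hA a ha b hb c hcc hab hbc hac
  · obtain ⟨rfl, rfl⟩ := hc b hb c hcc hbc
    have := hr a ha hab.symm; tauto
  · obtain ⟨rfl, rfl⟩ := hc a ha b hb hab
    obtain ⟨rfl, -⟩ := hc c hcc b hb hbc.symm
    exact absurd rfl hac
  · obtain ⟨rfl, rfl⟩ := hc a ha b hb hab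
    have := hs c hcc hbc; tauto
  · obtain ⟨rfl, rfl⟩ := hc b hb a ha hab.symm
    have := hr c hcc hbc; tauto
  · obtain ⟨rfl, rfl⟩ := hc b hb a ha hab.symm
    obtain ⟨-, rfl⟩ := hc b hb c hcc hbc
    exact absurd rfl hac
  · obtain ⟨rfl, rfl⟩ := hc c hcc b hb hbc.symm
    have := hs a ha hab.symm; tauto
  · exact hB a ha b hb c hcc hab hbc hac

/-- The invariant keeps the uncovered component of the root, of one or two vertices, disjoint from
the packing. At a join, if `r` or `s` is covered, the unions work. If both are uncovered, their
components merge: two single vertices give a new uncovered edge, and anything larger contains a path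
free for the packing, paid for by adding `r` to the cover. -/
theorem IsBranch.hasRootedDuality {V : Type*} [DecidableEq V] {G : SimpleGraph V} {A : Finset V}
    {r : V} (h : IsBranch G A r) : HasRootedDuality G A r := by
  induction h with
  | single r =>
    refine ⟨∅, ∅, by simp, by simp, by simpa using IsPathPacking.empty, ?_, ?_⟩ <;> simp
  | join A B r s hA hB hd hrs hc ihA ihB =>
    obtain ⟨C, U, hCA, hUA, hp, hcov, hst⟩ := ihA
    obtain ⟨C', U', hCB, hUB, hp', hcov', hst'⟩ := ihB
    have hrA := hA.root_mem
    have hsB := hB.root_mem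
    have hdl := Finset.disjoint_left.1 hd
    have hdr := Finset.disjoint_right.1 hd
    have hcard : (C ∪ C').card = C.card + C'.card :=
      Finset.card_union_of_disjoint (Finset.disjoint_of_subset_left hCA
        (Finset.disjoint_of_subset_right hCB hd))
    have hpu := hp.union hp' (Finset.disjoint_of_subset_left hUA
        (Finset.disjoint_of_subset_right hUB hd))
    rw [← hcard] at hpu
    have hrU' : r ∉ U' := fun h => hdl hrA (hUB h)
    have hsU : s ∉ U := fun h => hdr hsB (hUA h)
    have hcovA : ∀ a ∈ A, ∀ b ∈ A, ∀ c ∈ A, G.Adj a b → G.Adj b c → a ≠ c →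
        a ∈ C ∪ C' ∨ b ∈ C ∪ C' ∨ c ∈ C ∪ C' := cover_mono Finset.subset_union_left hcov
    have hcovB : ∀ a ∈ B, ∀ b ∈ B, ∀ c ∈ B, G.Adj a b → G.Adj b c → a ≠ c →
        a ∈ C ∪ C' ∨ b ∈ C ∪ C' ∨ c ∈ C ∪ C' := cover_mono Finset.subset_union_right hcov'
    -- The case where cover and packing both grow by one.
    have hins : r ∉ C → ∀ a b c, ({a, b, c} : Finset V) ⊆ A ∪ B → G.Adj a b → G.Adj b c → a ≠ c →
        a ∉ U ∪ U' → b ∉ U ∪ U' → c ∉ U ∪ U' → HasRootedDuality G (A ∪ B) r := by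
      intro hrC a b c hsub h1 h2 h3 ha hb hc'
      have hrn : r ∉ C ∪ C' := by
        rw [Finset.mem_union]; rintro (h | h)
        · exact hrC h
        · exact hdl hrA (hCB h)
      refine ⟨insert r (C ∪ C'), (U ∪ U') ∪ {a, b, c}, ?_, ?_, ?_, ?_, Or.inl (by simp)⟩
      · exact Finset.insert_subset (Finset.mem_union_left _ hrA) (Finset.union_subset_union hCA hCB)
      · exact Finset.union_subset (Finset.union_subset_union hUA hUB) hsub
      · rw [Finset.card_insert_of_notMem hrn]
        exact .add _ _ _ _ _ hpu h1 h2 h3 ha hb hc'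
      · exact cover_union (cover_mono (Finset.subset_insert _ _) hcovA)
          (cover_mono (Finset.subset_insert _ _) hcovB) hc
          (fun _ _ _ => Or.inl (Finset.mem_insert_self _ _))
          (fun _ _ _ => Or.inl (Finset.mem_insert_self _ _))
    by_cases hrC : r ∈ C
    · refine ⟨C ∪ C', U ∪ U', Finset.union_subset_union hCA hCB, Finset.union_subset_union hUA hUB,
        hpu, cover_union hcovA hcovB hc ?_ ?_, Or.inl (by simp [hrC])⟩ <;> simp [hrC]
    by_cases hsC : s ∈ C'
    · refine ⟨C ∪ C', U ∪ U', Finset.union_subset_union hCA hCB, Finset.union_subset_union hUA hUB,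
        hpu, cover_union hcovA hcovB hc (by simp [hsC]) (by simp [hsC]), ?_⟩
      rcases hst with h | ⟨h1, h2⟩ | ⟨r', hr', h1, h2, h3, h4, h5⟩
      · exact absurd h hrC
      · refine Or.inr (Or.inl ⟨by simp [h1, hrU'], fun y hy hry => ?_⟩)
        rcases Finset.mem_union.1 hy with hy | hy
        · exact Finset.mem_union_left _ (h2 y hy hry)
        · obtain ⟨-, rfl⟩ := hc r hrA y hy hry
          exact Finset.mem_union_right _ hsC
      · refine Or.inr (Or.inr ⟨r', Finset.mem_union_left _ hr', h1, by simp [h2, hrU'],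
          by simpa [h3] using fun h => hdl hr' (hUB h), fun y hy hry => ?_, fun y hy hry => ?_⟩)
        · rcases Finset.mem_union.1 hy with hy | hy
          · exact (h4 y hy hry).imp_left (Finset.mem_union_left _)
          · obtain ⟨-, rfl⟩ := hc r hrA y hy hry
            exact Or.inl (Finset.mem_union_right _ hsC)
        · rcases Finset.mem_union.1 hy with hy | hy
          · exact (h5 y hy hry).imp_left (Finset.mem_union_left _)
          · obtain ⟨rfl, -⟩ := hc r' hr' y hy hry
            exact absurd rfl h1.ne
    rcases hst with h | ⟨h1, h2⟩ | ⟨r', hr', h1, h2, h3, h4, h5⟩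
    · exact absurd h hrC
    · rcases hst' with h | ⟨h1', h2'⟩ | ⟨s', hs', h1', h2', h3', h4', h5'⟩
      · exact absurd h hsC
      · refine ⟨C ∪ C', U ∪ U', Finset.union_subset_union hCA hCB,
          Finset.union_subset_union hUA hUB, hpu, cover_union hcovA hcovB hc ?_ ?_, ?_⟩
        · intro y hy hry; simp [h2 y hy hry]
        · intro y hy hry; simp [h2' y hy hry]
        · refine Or.inr (Or.inr ⟨s, Finset.mem_union_right _ hsB, hrs, by simp [h1, hrU'],
            by simp [h1', hsU], fun y hy hry => ?_, fun y hy hry => ?_⟩)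
          · rcases Finset.mem_union.1 hy with hy | hy
            · exact Or.inl (Finset.mem_union_left _ (h2 y hy hry))
            · exact Or.inr (hc r hrA y hy hry).2
          · rcases Finset.mem_union.1 hy with hy | hy
            · exact Or.inr (hc y hy s hsB hry.symm).1
            · exact Or.inl (Finset.mem_union_right _ (h2' y hy hry))
      · refine hins hrC r s s' ?_ hrs h1' ?_ (by simp [h1, hrU']) (by simp [h2', hsU]) ?_
        · simp [Finset.insert_subset_iff, hrA, hsB, hs']
        · rintro rfl; exact hdl hrA hs'
        · simpa [h3'] using fun h => hdr hs' (hUA h)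
    · refine hins hrC r' r s ?_ h1.symm hrs ?_ ?_ (by simp [h2, hrU']) ?_
      · simp [Finset.insert_subset_iff, hrA, hsB, hr']
      · rintro rfl; exact hdl hr' hsB
      · simpa [h3] using fun h => hdl hr' (hUB h)
      · have : s ∉ U' := by
          rcases hst' with h | ⟨h1', h2'⟩ | ⟨s', hs', h1', h2', h3', h4', h5'⟩
          · exact absurd h hsC
          · exact h1'
          · exact h2'
        simp [this, hsU]

/-- In a tree, the minimum number of vertices meeting all paths on three vertices is the maximum
number of disjoint such paths. -/
theorem SimpleGraph.IsTree.exists_cover_eq_packing {V : Type*} [Fintype V] {G : SimpleGraph V}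
    (hG : G.IsTree) : ∃ (t : ℕ) (C : Finset V) (q : Fin t → Fin 3 → V),
      IsPathCover G C ∧ C.card = t ∧ IsPathFamily G q := by
  classical
  obtain ⟨r, hr⟩ := hG.exists_isBranch
  obtain ⟨C, U, -, -, hp, hcov, -⟩ := hr.hasRootedDuality
  obtain ⟨q, hq, -⟩ := hp.exists_isPathFamily
  exact ⟨C.card, C, q, fun a b c => hcov a (by simp) b (by simp) c (by simp), rfl, hq⟩

/-! ### Minimum covers as transversals of a packing -/

/-- The transversal of the family `q` that picks the vertex `q i (x i)` from the `i`-th path. -/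
def transversal {V ι : Type*} [Fintype ι] [DecidableEq V] (q : ι → Fin 3 → V) (x : ι → Fin 3) :
    Finset V :=
  Finset.univ.image fun i => q i (x i)

open Classical in
/-- The choices whose transversal is a path cover. -/
noncomputable def coveringChoices {V ι : Type*} [Fintype ι] [DecidableEq V]
    (G : SimpleGraph V) (q : ι → Fin 3 → V) : Finset (ι → Fin 3) :=
  Finset.univ.filter fun x => IsPathCover G (transversal q x)

theorem mem_coveringChoices {V ι : Type*} [Fintype ι] [DecidableEq V]
    {G : SimpleGraph V} {q : ι → Fin 3 → V} {x : ι → Fin 3} :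
    x ∈ coveringChoices G q ↔ IsPathCover G (transversal q x) := by
  simp [coveringChoices]

theorem IsPathFamily.mem_transversal {V ι : Type*} [Fintype ι] [DecidableEq V]
    {G : SimpleGraph V} {q : ι → Fin 3 → V} (hq : IsPathFamily G q) {x : ι → Fin 3} {i : ι}
    {j : Fin 3} : q i j ∈ transversal q x ↔ x i = j := by
  unfold transversal
  rw [Finset.mem_image]
  constructor
  · rintro ⟨i', -, h⟩
    obtain ⟨rfl, h'⟩ := hq.inj _ _ _ _ h
    exact h'
  · rintro rfl
    exact ⟨i, Finset.mem_univ _, rfl⟩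

theorem notMem_transversal {V ι : Type*} [Fintype ι] [DecidableEq V]
    {q : ι → Fin 3 → V} {w : V} (hw : ∀ i j, q i j ≠ w) (x : ι → Fin 3) :
    w ∉ transversal q x := by
  unfold transversal
  rw [Finset.mem_image]
  rintro ⟨i, -, h⟩
  exact hw _ _ h

theorem IsPathFamily.card_transversal {V ι : Type*} [Fintype ι] [DecidableEq V]
    {G : SimpleGraph V} {q : ι → Fin 3 → V} (hq : IsPathFamily G q) (x : ι → Fin 3) :
    (transversal q x).card = Fintype.card ι := by
  unfold transversal
  rw [Finset.card_image_of_injective _ fun i i' h => (hq.inj _ _ _ _ h).1]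
  rfl

theorem IsPathFamily.exists_transversal_subset {V ι : Type*} [Fintype ι] [DecidableEq V]
    {G : SimpleGraph V} {q : ι → Fin 3 → V} (hq : IsPathFamily G q) {C : Finset V}
    (hC : IsPathCover G C) : ∃ x, transversal q x ⊆ C := by
  have : ∀ i, ∃ j, q i j ∈ C := fun i => by
    rcases hC _ _ _ (hq.adj01 i) (hq.adj12 i) (fun h => by simpa using (hq.inj _ _ _ _ h).2)
      with h | h | h
    exacts [⟨_, h⟩, ⟨_, h⟩, ⟨_, h⟩]
  choose x hx using this
  exact ⟨x, Finset.image_subset_iff.2 fun i _ => hx i⟩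

/-- A cover contains a transversal, which has as many vertices as there are paths; a cover of that
size is therefore a transversal, and disjointness of the paths makes the choice unique. -/
theorem IsPathFamily.numMaximumDissociationSets_eq {V ι : Type*} [Fintype V] [Fintype ι]
    [DecidableEq V] {G : SimpleGraph V} {q : ι → Fin 3 → V} (hq : IsPathFamily G q)
    (hex : ∃ C : Finset V, IsPathCover G C ∧ C.card = Fintype.card ι) :
    numMaximumDissociationSets G = (coveringChoices G q).card := by
  have hmin : ∀ C : Finset V, IsPathCover G C → Fintype.card ι ≤ C.card := fun C hC => by
    obtain ⟨x, hx⟩ := hq.exists_transversal_subset hC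
    rw [← hq.card_transversal x]
    exact Finset.card_le_card hx
  rw [_root_.numMaximumDissociationSets_eq G _ hex hmin]
  have hinj : Function.Injective (transversal q) := fun x y h => by
    funext i
    have : q i (x i) ∈ transversal q y := h ▸ hq.mem_transversal.2 rfl
    exact (hq.mem_transversal.1 this).symm
  rw [← Set.ncard_coe_finset, ← Set.ncard_image_of_injective _ hinj]
  congr 1
  ext C
  simp only [Set.mem_ofPred_eq, Set.mem_image, Finset.mem_coe, mem_coveringChoices]
  constructor
  · rintro ⟨hC, hcard⟩
    obtain ⟨x, hx⟩ := hq.exists_transversal_subset hC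
    have := Finset.eq_of_subset_of_card_le hx (by rw [hcard, hq.card_transversal])
    exact ⟨x, this ▸ hC, this⟩
  · rintro ⟨x, hx, rfl⟩
    exact ⟨hx, hq.card_transversal x⟩

/-- A bound for a set of choices whose restrictions to the coordinates `e` lie in `A`. -/
theorem card_choices_le {ι κ β : Type*} [Fintype ι] [Fintype κ] (S : Finset (ι → Fin 3))
    (e : κ → ι) (he : Function.Injective e) (p : (κ → Fin 3) → β) (hp : Function.Injective p)
    (A : Finset β) (h : ∀ x ∈ S, p (fun k => x (e k)) ∈ A) :
    S.card ≤ A.card * 3 ^ (Fintype.card ι - Fintype.card κ) := by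
  classical
  have hc : Fintype.card {i // i ∉ Set.range e} = Fintype.card ι - Fintype.card κ := by
    rw [Fintype.card_subtype_compl, ← Set.card_range_of_injective he]
  rw [← hc]
  calc S.card ≤ (A ×ˢ (Finset.univ : Finset ({i // i ∉ Set.range e} → Fin 3))).card := by
        refine Finset.card_le_card_of_injOn (fun x => (p fun k => x (e k), fun i => x i.1)) ?_ ?_
        · intro x hx
          simpa using h x hx
        · intro x _ y _ hxy
          funext i
          by_cases hi : i ∈ Set.range e
          · obtain ⟨k, rfl⟩ := hi
            exact congrFun (hp (congrArg Prod.fst hxy)) k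
          · exact congrFun (congrArg Prod.snd hxy) ⟨i, hi⟩
    _ = _ := by simp [Finset.card_product]

/-! ### Parent functions and the extremal trees -/

/-- The graph with an edge between each vertex and its image under the parent function `p`. -/
def parentGraph {U : Type*} (p : U → U) : SimpleGraph U :=
  SimpleGraph.fromRel fun x y => p x = y

theorem parentGraph_adj {U : Type*} {p : U → U} {x y : U} :
    (parentGraph p).Adj x y ↔ x ≠ y ∧ (p x = y ∨ p y = x) :=
  SimpleGraph.fromRel_adj _ _ _

/-- Following parents connects every vertex to the root, and each edge is `s(x, p x)` for some
non-root `x`, which leaves at most `|U| - 1` edges. -/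
theorem parentGraph_isTree {U : Type*} [Fintype U] {p : U → U} (r : U)
    (hr : p r = r) (hreach : ∀ x, ∃ n, p^[n] x = r) : (parentGraph p).IsTree := by
  classical
  have hstep : ∀ x, (parentGraph p).Reachable x (p x) := fun x => by
    by_cases hx : x = p x
    · rw [← hx]
    · exact SimpleGraph.Adj.reachable (parentGraph_adj.2 ⟨hx, Or.inl rfl⟩)
  have hit : ∀ n x, (parentGraph p).Reachable x (p^[n] x) := fun n => by
    induction n with
    | zero => exact fun x => SimpleGraph.Reachable.refl _
    | succ n ih => exact fun x => (hstep x).trans (ih (p x))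
  have hroot : ∀ x, (parentGraph p).Reachable x r := fun x => by
    obtain ⟨n, hn⟩ := hreach x
    exact hn ▸ hit n x
  have hc : (parentGraph p).Connected :=
    { preconnected := fun x y => (hroot x).trans (hroot y).symm, nonempty := ⟨r⟩ }
  rw [SimpleGraph.isTree_iff_connected_and_card]
  refine ⟨hc, le_antisymm ?_ ?_⟩
  · have hsub : (parentGraph p).edgeFinset ⊆
        (Finset.univ.erase r).image fun x => s(x, p x) := by
      intro z hz
      induction z with
      | _ x y =>
        rw [SimpleGraph.mem_edgeFinset, SimpleGraph.mem_edgeSet, parentGraph_adj] at hz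
        obtain ⟨hne, h | h⟩ := hz
        · refine Finset.mem_image.2 ⟨x, Finset.mem_erase.2 ⟨?_, Finset.mem_univ _⟩, by rw [h]⟩
          rintro rfl
          exact hne (hr.symm.trans h)
        · refine Finset.mem_image.2 ⟨y, Finset.mem_erase.2 ⟨?_, Finset.mem_univ _⟩,
            by rw [h]; exact Sym2.eq_swap⟩
          rintro rfl
          exact hne (h.symm.trans hr)
    have h1 := (Finset.card_le_card hsub).trans Finset.card_image_le
    rw [Finset.card_erase_of_mem (Finset.mem_univ _), Finset.card_univ] at h1
    rw [Nat.card_eq_fintype_card, Nat.card_eq_fintype_card, ← SimpleGraph.edgeFinset_card]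
    have : 0 < Fintype.card U := Fintype.card_pos_iff.2 ⟨r⟩
    omega
  · exact hc.card_vert_le_card_edgeSet_add_one

/-- A tree containing a bijective image of a parent graph is isomorphic to it. -/
theorem SimpleGraph.IsTree.nonempty_iso_parentGraph {U V : Type*} [Fintype U] [Fintype V]
    {G : SimpleGraph V} (hG : G.IsTree) {p : U → U} (r : U)
    (hr : p r = r) (h : ∀ x, ∃ n, p^[n] x = r) {f : U → V} (hf : f.Injective)
    (hcard : Fintype.card V = Fintype.card U) (hadj : ∀ x, x ≠ r → G.Adj (f x) (f (p x))) :
    Nonempty (G ≃g parentGraph p) := by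
  refine hG.nonempty_iso_of_bijective (parentGraph_isTree r hr h) f
    ((Fintype.bijective_iff_injective_and_card f).2 ⟨hf, hcard.symm⟩) fun x y hxy => ?_
  rw [parentGraph_adj] at hxy
  obtain ⟨hne, rfl | rfl⟩ := hxy
  · exact hadj x (by rintro rfl; exact hne hr.symm)
  · exact (hadj y (by rintro rfl; exact hne hr)).symm

/-- The vertices of the extremal trees: a centre, four vertices near it, and `k` triples. -/
abbrev StarVertex (k : ℕ) : Type := Option (Fin 4 ⊕ Fin k × Fin 3)

/-- The parent function of the extremal tree whose central part is `P_3, P_3` (`t = 0`),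
`P_2, P_2, P_2, P_2` (`t = 1`) or `P_3, P_2, P_2` (`t = 2`), and whose `i`-th triple forms with
the centre a path if `b i` and a claw otherwise. -/
def starParent {k : ℕ} (t : Fin 3) (b : Fin k → Bool) : StarVertex k → StarVertex k
  | none => none
  | some (Sum.inl j) => ![none, if t = 1 then none else some (Sum.inl 0), none,
      if t = 0 then some (Sum.inl 2) else none] j
  | some (Sum.inr (i, j)) =>
    if b i then ![none, some (Sum.inr (i, 0)), some (Sum.inr (i, 1))] j
    else ![some (Sum.inr (i, 1)), none, some (Sum.inr (i, 1))] j

/-- The extremal trees. -/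
def starTree {k : ℕ} (t : Fin 3) (b : Fin k → Bool) : SimpleGraph (StarVertex k) :=
  parentGraph (starParent t b)

theorem starParent_iterate {k : ℕ} (t : Fin 3) (b : Fin k → Bool) (x : StarVertex k) :
    (starParent t b)^[3] x = none := by
  rcases x with _ | j | ⟨i, j⟩
  · rfl
  · fin_cases t <;> fin_cases j <;> rfl
  · by_cases h : b i <;> fin_cases j <;> simp [starParent, h]

theorem starTree_isTree {k : ℕ} (t : Fin 3) (b : Fin k → Bool) : (starTree t b).IsTree :=
  parentGraph_isTree none rfl fun x => ⟨3, starParent_iterate t b x⟩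

theorem card_starVertex (k : ℕ) : Fintype.card (StarVertex k) = 3 * k + 5 := by
  simp; ring

/-- A path packing of the extremal tree. -/
def starFamily (k : ℕ) : Option (Fin k) → Fin 3 → StarVertex k
  | none => ![some (Sum.inl 0), none, some (Sum.inl 2)]
  | some i => fun j => some (Sum.inr (i, j))

theorem starFamily_isPathFamily {k : ℕ} (t : Fin 3) (b : Fin k → Bool) :
    IsPathFamily (starTree t b) (starFamily k) where
  inj := by
    rintro (_ | i) j (_ | i') j' h
    · fin_cases j <;> fin_cases j' <;> simp_all [starFamily]
    · fin_cases j <;> simp [starFamily] at h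
    · fin_cases j' <;> simp [starFamily] at h
    · simpa [starFamily] using h
  adj01 := by
    rintro (_ | i)
    · simp [starFamily, starTree, parentGraph_adj, starParent]
    · by_cases h : b i <;> simp [starFamily, starTree, parentGraph_adj, starParent, h]
  adj12 := by
    rintro (_ | i)
    · simp [starFamily, starTree, parentGraph_adj, starParent]
    · by_cases h : b i <;> simp [starFamily, starTree, parentGraph_adj, starParent, h]

theorem starTree_adj_inr {k : ℕ} {t : Fin 3} {b : Fin k → Bool} {i : Fin k} {j : Fin 3}
    {y : StarVertex k} (h : (starTree t b).Adj (some (Sum.inr (i, j))) y) :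
    y = none ∨ ∃ j', j' ≠ j ∧ y = some (Sum.inr (i, j')) := by
  have hne := h.ne
  have hor : y = none ∨ ∃ j', y = some (Sum.inr (i, j')) := by
    rw [starTree, parentGraph_adj] at h
    obtain ⟨-, rfl | h⟩ := h
    · by_cases h : b i <;> fin_cases j <;> simp [starParent, h]
    · rcases y with _ | j' | ⟨i', j'⟩
      · exact Or.inl rfl
      · fin_cases t <;> fin_cases j' <;> simp [starParent] at h
      · by_cases h' : b i' <;> fin_cases j' <;> simp [starParent, h'] at h <;> simp [h]
  rcases hor with h | ⟨j', rfl⟩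
  · exact Or.inl h
  · exact Or.inr ⟨j', by rintro rfl; exact hne rfl, rfl⟩

theorem starTree_adj_inl {k : ℕ} {t : Fin 3} {b : Fin k → Bool} {j : Fin 4}
    {y : StarVertex k} (h : (starTree t b).Adj (some (Sum.inl j)) y) :
    y = none ∨ y = some (Sum.inl (![1, 0, 3, 2] j)) := by
  rw [starTree, parentGraph_adj] at h
  obtain ⟨-, rfl | h⟩ := h
  · fin_cases t <;> fin_cases j <;> simp [starParent]
  · rcases y with _ | j' | ⟨i', j'⟩
    · exact Or.inl rfl
    · fin_cases t <;> fin_cases j' <;> fin_cases j <;> simp [starParent] at h ⊢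
    · by_cases h' : b i' <;> fin_cases j' <;> simp [starParent, h'] at h

/-- Without the centre, the central path can be hit on one side only, and the two central vertices
of the other side form an unhit path with the centre. With the centre removed, the components are
central pieces of at most two vertices and the triples, each of which is hit once by any choice. -/
theorem mem_coveringChoices_starTree {k : ℕ} (t : Fin 3) (b : Fin k → Bool)
    (x : Option (Fin k) → Fin 3) :
    x ∈ coveringChoices (starTree t b) (starFamily k) ↔ x none = 1 := by
  have hq := starFamily_isPathFamily t b
  have hn : ∀ j, (some (Sum.inl j) : StarVertex k) ∈ transversal (starFamily k) x ↔
      (j = 0 ∧ x none = 0) ∨ (j = 2 ∧ x none = 2) := by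
    intro j
    simp only [transversal, Finset.mem_image, Finset.mem_univ, true_and]
    constructor
    · rintro ⟨_ | i, h⟩
      · revert h
        generalize x none = a
        fin_cases a <;> simp [starFamily] <;> tauto
      · simp [starFamily] at h
    · rintro (⟨rfl, h⟩ | ⟨rfl, h⟩) <;> exact ⟨none, by simp [h, starFamily]⟩
  have hroot : (none : StarVertex k) ∈ transversal (starFamily k) x ↔ x none = 1 :=
    hq.mem_transversal (i := none) (j := 1)
  rw [mem_coveringChoices]
  constructor
  · intro h
    by_contra hx
    have hx' : x none = 0 ∨ x none = 2 := by
      revert hx; generalize x none = a; revert a; decide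
    -- The paths centre, `a`, `c` are used when the unhit side is a `P_3`; `hadj'` treats `a`,
    -- centre, `c` when it is two copies of `P_2`.
    have hadj : ∀ a c : Fin 4, (starTree t b).Adj (some (Sum.inl a)) (some (Sum.inl c)) →
        (starTree t b).Adj none (some (Sum.inl a)) → a ≠ c →
        ¬ ((a = 0 ∨ c = 0) ∧ x none = 0) → ¬ ((a = 2 ∨ c = 2) ∧ x none = 2) → False := by
      intro a c hac ha hne h0 h2
      have := h none _ _ ha hac (by simp)
      rw [hroot, hn, hn] at this
      tauto
    have hadj' : ∀ a c : Fin 4, (starTree t b).Adj none (some (Sum.inl a)) →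
        (starTree t b).Adj none (some (Sum.inl c)) → a ≠ c →
        ¬ ((a = 0 ∨ c = 0) ∧ x none = 0) → ¬ ((a = 2 ∨ c = 2) ∧ x none = 2) → False := by
      intro a c ha hc hne h0 h2
      have := h _ none _ ha.symm hc (by simpa using hne)
      rw [hroot, hn, hn] at this
      tauto
    rcases hx' with hx' | hx'
    · by_cases ht : t = 0
      · subst ht
        exact hadj 2 3 (by simp [starTree, parentGraph_adj, starParent])
          (by simp [starTree, parentGraph_adj, starParent]) (by decide) (by simp [hx'])
          (by simp [hx'])
      · exact hadj' 2 3 (by simp [starTree, parentGraph_adj, starParent])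
          (by simp [starTree, parentGraph_adj, starParent, ht]) (by decide) (by simp [hx'])
          (by simp [hx'])
    · by_cases ht : t = 1
      · exact hadj' 0 1 (by simp [starTree, parentGraph_adj, starParent])
          (by simp [starTree, parentGraph_adj, starParent, ht]) (by decide) (by simp [hx'])
          (by simp [hx'])
      · exact hadj 0 1 (by simp [starTree, parentGraph_adj, starParent, ht])
          (by simp [starTree, parentGraph_adj, starParent]) (by decide) (by simp [hx'])
          (by simp [hx'])
  · intro h u v w huv hvw huw
    have hr := hroot.2 h
    rcases v with _ | j | ⟨i, j⟩
    · exact Or.inr (Or.inl hr)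
    · rcases starTree_adj_inl huv.symm with rfl | rfl
      · exact Or.inl hr
      · rcases starTree_adj_inl hvw with rfl | rfl
        · exact Or.inr (Or.inr hr)
        · exact absurd rfl huw
    · rcases starTree_adj_inr huv.symm with rfl | ⟨j', hj', rfl⟩
      · exact Or.inl hr
      · rcases starTree_adj_inr hvw with rfl | ⟨j'', hj'', rfl⟩
        · exact Or.inr (Or.inr hr)
        · have hm : ∀ j, (some (Sum.inr (i, j)) : StarVertex k) ∈ transversal (starFamily k) x ↔
              x (some i) = j := fun j => hq.mem_transversal (i := some i)
          rw [hm, hm, hm]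
          have : j' ≠ j'' := fun h => huw (by rw [h])
          generalize x (some i) = a
          clear huv hvw huw
          revert a j j' j''
          decide

theorem numMaximumDissociationSets_starTree {k : ℕ} (t : Fin 3) (b : Fin k → Bool) :
    numMaximumDissociationSets (starTree t b) = 3 ^ k := by
  have hq := starFamily_isPathFamily t b
  have hmem := mem_coveringChoices_starTree t b
  rw [hq.numMaximumDissociationSets_eq]
  · refine le_antisymm ?_ ?_
    · have := card_choices_le (coveringChoices (starTree t b) (starFamily k))
        (fun _ : Unit => (none : Option (Fin k))) (Function.injective_of_subsingleton _)
        id Function.injective_id {fun _ => 1} (fun x hx => by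
          rw [Finset.mem_singleton]; funext; exact (hmem x).1 hx)
      simpa using this
    · have := Finset.card_le_card_of_injOn (s := (Finset.univ : Finset (Fin k → Fin 3)))
        (t := coveringChoices (starTree t b) (starFamily k))
        (fun y o => o.elim 1 y) (fun y _ => by simp [hmem]) (fun y _ z _ h => by
          funext i; exact congrFun h (some i))
      simpa using this
  · exact ⟨_, mem_coveringChoices.1 ((hmem fun _ => 1).2 rfl), hq.card_transversal _⟩

/-! ### The extremal trees are exactly the trees in the `S^*` families -/

theorem isLeaf_iff {V : Type*} {G : SimpleGraph V} {v : V} :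
    IsLeaf G v ↔ ∃ u, G.Adj v u ∧ ∀ w, G.Adj v w → w = u := by
  rw [IsLeaf, Set.encard_eq_one]
  refine exists_congr fun u => ?_
  rw [Set.eq_singleton_iff_unique_mem]
  rfl

theorem IsLeaf.map_iso {V W : Type*} {G : SimpleGraph V} {H : SimpleGraph W} (φ : G ≃g H) {v : V}
    (h : IsLeaf G v) : IsLeaf H (φ v) := by
  rw [isLeaf_iff] at h ⊢
  obtain ⟨u, h1, h2⟩ := h
  refine ⟨φ u, φ.map_adj_iff.2 h1, fun w hw => ?_⟩
  obtain ⟨w, rfl⟩ := φ.surjective w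
  rw [h2 w (φ.map_adj_iff.1 hw)]

theorem IsSStar.of_iso {V W ι : Type*} {G : SimpleGraph V} {H : SimpleGraph W} {T : ι → FinGraph}
    (φ : G ≃g H) (h : IsSStar H T) : IsSStar G T := by
  obtain ⟨v, B, hv, hiso, hleaf, hdisj, huniv, hadj⟩ := h
  refine ⟨φ.symm v, fun i => φ ⁻¹' B i, fun i => by simpa using hv i, fun i => ?_, fun i => ?_,
    fun i j hij => ?_, ?_, fun x y hxy => ?_⟩
  · obtain ⟨e⟩ := hiso i
    exact ⟨(RelIso.trans ⟨φ.toEquiv.subtypeEquiv fun _ => Iff.rfl, φ.map_adj_iff⟩ e :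
      G.induce (φ ⁻¹' B i) ≃g _)⟩
  · have := (hleaf i).map_iso (RelIso.symm ⟨φ.toEquiv.subtypeEquiv fun _ => Iff.rfl,
      φ.map_adj_iff⟩ : H.induce (B i) ≃g G.induce (φ ⁻¹' B i))
    exact this
  · rw [← Set.preimage_inter, hdisj i j hij]
    ext x
    simp only [Set.mem_preimage, Set.mem_singleton_iff]
    constructor
    · rintro rfl; simp
    · rintro rfl; simp
  · rw [← Set.preimage_iUnion, huniv, Set.preimage_univ]
  · exact hadj _ _ (φ.map_adj_iff.2 hxy)

/-- `W` induces a copy of `T` in which `v` is a leaf. -/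
def IsLeafCopy {V : Type*} (G : SimpleGraph V) (W : Set V) (v : V) (T : FinGraph) : Prop :=
  ∃ (h : Fin T.1 → V) (z : Fin T.1), h.Injective ∧ Set.range h = W ∧ h z = v ∧
    (∀ a b, G.Adj (h a) (h b) ↔ T.2.Adj a b) ∧ IsLeaf T.2 z

theorem IsLeafCopy.exists_iso {V : Type*} {G : SimpleGraph V} {W : Set V} {v : V} {T : FinGraph}
    (h : IsLeafCopy G W v T) : ∃ hv : v ∈ W,
      Nonempty (G.induce W ≃g T.2) ∧ IsLeaf (G.induce W) ⟨v, hv⟩ := by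
  obtain ⟨h, z, hinj, rfl, rfl, hadj, hleaf⟩ := h
  let e : T.2 ≃g G.induce (Set.range h) := ⟨Equiv.ofInjective h hinj, hadj _ _⟩
  exact ⟨⟨z, rfl⟩, ⟨e.symm⟩, hleaf.map_iso e⟩

theorem isSStar_of_isLeafCopy {V ι : Type*} {G : SimpleGraph V} {T : ι → FinGraph} (v : V)
    (W : ι → Set V) (hW : ∀ i, IsLeafCopy G (W i) v (T i))
    (hdisj : ∀ i j, i ≠ j → W i ∩ W j = {v}) (huniv : (⋃ i, W i) = Set.univ)
    (hadj : ∀ x y, G.Adj x y → ∃ i, x ∈ W i ∧ y ∈ W i) : IsSStar G T :=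
  ⟨v, W, fun i => (hW i).exists_iso.1, fun i => (hW i).exists_iso.2.1,
    fun i => (hW i).exists_iso.2.2, hdisj, huniv, hadj⟩

theorem isLeafCopy_mk {V : Type*} {G : SimpleGraph V} {W : Set V} {v : V} {n : ℕ}
    {H : SimpleGraph (Fin n)} (h : Fin n → V) (z u : Fin n) (hinj : h.Injective)
    (hW : Set.range h = W) (hz : h z = v) (hadj : ∀ a b, G.Adj (h a) (h b) ↔ H.Adj a b)
    (hu : H.Adj z u) (huniq : ∀ w, H.Adj z w → w = u) : IsLeafCopy G W v ⟨n, H⟩ :=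
  ⟨h, z, hinj, hW, hz, hadj, isLeaf_iff.2 ⟨u, hu, huniq⟩⟩

theorem isLeafCopy_path_two {V : Type*} {G : SimpleGraph V} {v a : V} (h : G.Adj v a) :
    IsLeafCopy G {v, a} v (pathFinGraph 2) := by
  have h1 := h.ne
  refine isLeafCopy_mk (H := SimpleGraph.pathGraph 2) ![v, a] 0 1 ?_ ?_ rfl ?_
    (by simp [SimpleGraph.pathGraph_adj]) ?_
  · intro i j hij
    fin_cases i <;> fin_cases j <;> simp_all
  · ext; simp; tauto
  · intro i j
    fin_cases i <;> fin_cases j <;> simp [SimpleGraph.pathGraph_adj, h, h.symm]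
  · intro i hi
    fin_cases i <;> simp_all [SimpleGraph.pathGraph_adj]

theorem isLeafCopy_path_three {V : Type*} {G : SimpleGraph V} {v a b : V} (h : G.Adj v a)
    (h' : G.Adj a b) (hb : v ≠ b) (hvb : ¬ G.Adj v b) :
    IsLeafCopy G {v, a, b} v (pathFinGraph 3) := by
  have h1 := h.ne
  have h2 := h'.ne
  have hbv : ¬ G.Adj b v := fun h => hvb h.symm
  refine isLeafCopy_mk (H := SimpleGraph.pathGraph 3) ![v, a, b] 0 1 ?_ ?_ rfl ?_
    (by simp [SimpleGraph.pathGraph_adj]) ?_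
  · intro i j hij
    fin_cases i <;> fin_cases j <;> simp_all
  · ext; simp; tauto
  · intro i j
    fin_cases i <;> fin_cases j <;>
      simp [SimpleGraph.pathGraph_adj, h, h.symm, h', h'.symm, hvb, hbv]
  · intro i hi
    fin_cases i <;> simp_all [SimpleGraph.pathGraph_adj]

/-- The claw with leaves `0, 1, 3` and centre `2`. -/
def claw : SimpleGraph (Fin 4) :=
  SimpleGraph.fromRel fun a _ => a = 2

theorem isP4OrK13_claw : IsP4OrK13 ⟨4, claw⟩ := by
  refine Or.inr ⟨⟨⟨![Sum.inr 0, Sum.inr 1, Sum.inl 0, Sum.inr 2],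
    Sum.elim (fun _ => 2) ![0, 1, 3], ?_, ?_⟩, ?_⟩⟩
  · intro x; change Fin 4 at x; fin_cases x <;> rfl
  · rintro (x | x) <;> fin_cases x <;> rfl
  · intro a b
    change Fin 4 at a b
    fin_cases a <;> fin_cases b <;> simp [claw]

theorem starTree_isLeafCopy_triple {k : ℕ} (t : Fin 3) (b : Fin k → Bool) (i : Fin k) :
    IsLeafCopy (starTree t b) {none, some (Sum.inr (i, 0)), some (Sum.inr (i, 1)),
      some (Sum.inr (i, 2))} none (if b i then pathFinGraph 4 else ⟨4, claw⟩) := by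
  have hinj : Function.Injective (![none, some (Sum.inr (i, 0)), some (Sum.inr (i, 1)),
      some (Sum.inr (i, 2))] : Fin 4 → StarVertex k) := by
    intro i j hij
    fin_cases i <;> fin_cases j <;> simp_all
  by_cases hb : b i
  · rw [if_pos hb]
    refine isLeafCopy_mk (H := SimpleGraph.pathGraph 4) _ 0 1 hinj (by ext; simp; tauto) rfl ?_
      (by simp [SimpleGraph.pathGraph_adj]) ?_
    · intro i j
      fin_cases i <;> fin_cases j <;>
        simp [SimpleGraph.pathGraph_adj, starTree, parentGraph_adj, starParent, hb]
    · intro i hi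
      fin_cases i <;> simp_all [SimpleGraph.pathGraph_adj]
  · rw [if_neg hb]
    refine isLeafCopy_mk (H := claw) _ 0 2 hinj (by ext; simp; tauto) rfl ?_
      (by simp [claw]) ?_
    · intro i j
      fin_cases i <;> fin_cases j <;> simp [claw, starTree, parentGraph_adj, starParent, hb]
    · intro i hi
      fin_cases i <;> simp_all [claw]

/-- The map `c` names the piece containing each central vertex; `hc01` and `hc23` ensure that
central vertices joined by an edge get the same piece. -/
theorem starTree_inSStarFamily {k a : ℕ} (t : Fin 3) (b : Fin k → Bool) (A : Fin a → FinGraph)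
    (c : Fin 4 → Fin a) (hc01 : t ≠ 1 → c 1 = c 0) (hc23 : t = 0 → c 3 = c 2)
    (hA : ∀ i, IsLeafCopy (starTree t b) {x | x = none ∨ ∃ j, c j = i ∧ x = some (Sum.inl j)}
      none (A i)) : InSStarFamily (starTree t b) A k := by
  refine ⟨fun i => if b i then pathFinGraph 4 else ⟨4, claw⟩, fun i => ?_, ?_⟩
  · by_cases hb : b i
    · simp only [hb, if_true]
      exact Or.inl ⟨RelIso.refl _⟩
    · simp only [hb]
      exact isP4OrK13_claw
  -- Each piece is a fibre of `Sum.map c Prod.fst` together with the centre, so disjointness away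
  -- from the centre is automatic.
  · obtain ⟨W, hW0, hW⟩ : ∃ W : Fin a ⊕ Fin k → Set (StarVertex k), (∀ i, none ∈ W i) ∧
        ∀ i y, some y ∈ W i ↔ Sum.map c Prod.fst y = i :=
      ⟨fun i => {y | ∀ y', y = some y' → Sum.map c Prod.fst y' = i},
        fun i y' h => by simp at h, fun i y => ⟨fun h => h y rfl, by rintro h y' ⟨⟩; exact h⟩⟩
    refine isSStar_of_isLeafCopy none W ?_ ?_ ?_ ?_
    · rintro (i | i)
      · have : W (Sum.inl i) = {x | x = none ∨ ∃ j, c j = i ∧ x = some (Sum.inl j)} := by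
          ext (_ | j | ⟨i', j⟩) <;> simp [hW, hW0]
        rw [this]
        exact hA i
      · have : W (Sum.inr i) = {none, some (Sum.inr (i, 0)), some (Sum.inr (i, 1)),
            some (Sum.inr (i, 2))} := by
          ext (_ | j | ⟨i', j⟩)
          · simp [hW0]
          · simp [hW]
          · fin_cases j <;> simp [hW]
        rw [this]
        exact starTree_isLeafCopy_triple t b i
    · intro i j hij
      ext (_ | y)
      · simp [hW0]
      · simp only [Set.mem_inter_iff, hW, Set.mem_singleton_iff, reduceCtorEq, iff_false, not_and]
        rintro rfl
        exact hij
    · ext (_ | y)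
      · simpa only [Set.mem_iUnion, Set.mem_univ, iff_true] using ⟨Sum.inl (c 0), hW0 _⟩
      · simpa only [Set.mem_iUnion, Set.mem_univ, iff_true] using ⟨_, (hW _ y).2 rfl⟩
    · have hp : ∀ y y', starParent t b (some y) = some y' →
          Sum.map c (Prod.fst : Fin k × Fin 3 → Fin k) y' = Sum.map c Prod.fst y := by
        rintro (j | ⟨i, j⟩) y' h
        · fin_cases t <;> fin_cases j <;> simp [starParent] at h <;> subst h <;> simp_all
        · by_cases hb : b i <;> fin_cases j <;> simp [starParent, hb] at h <;> subst h <;> simp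
      intro x y hxy
      rw [starTree, parentGraph_adj] at hxy
      obtain ⟨hne, h⟩ := hxy
      rcases x with _ | x <;> rcases y with _ | y
      · exact absurd rfl hne
      · exact ⟨_, hW0 _, (hW _ y).2 rfl⟩
      · exact ⟨_, (hW _ x).2 rfl, hW0 _⟩
      · refine ⟨_, (hW _ x).2 rfl, (hW _ y).2 ?_⟩
        rcases h with h | h
        · exact hp _ _ h
        · exact (hp _ _ h).symm

theorem starTree_inExtremalSStarFamilies {k : ℕ} (t : Fin 3) (b : Fin k → Bool) :
    InExtremalSStarFamilies (starTree t b) k := by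
  have hset2 : ∀ (c : Fin 4 → Prop) (j : Fin 4), (∀ l, c l ↔ l = j) →
      ({x : StarVertex k | x = none ∨ ∃ l, c l ∧ x = some (Sum.inl l)} : Set (StarVertex k)) =
        {none, some (Sum.inl j)} := by
    intro c j h; ext x; simp [h]
  have hset3 : ∀ (c : Fin 4 → Prop) (j j' : Fin 4), (∀ l, c l ↔ l = j ∨ l = j') →
      ({x : StarVertex k | x = none ∨ ∃ l, c l ∧ x = some (Sum.inl l)} : Set (StarVertex k)) =
        {none, some (Sum.inl j), some (Sum.inl j')} := by
    intro c j j' h; ext x; simp [h, or_and_right, exists_or]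
  fin_cases t
  · refine Or.inl (starTree_inSStarFamily _ _ _ ![0, 0, 1, 1] (by simp) (by simp) fun i => ?_)
    fin_cases i
    · rw [hset3 _ 0 1 (by decide)]
      apply isLeafCopy_path_three <;> simp [starTree, parentGraph_adj, starParent]
    · rw [hset3 _ 2 3 (by decide)]
      apply isLeafCopy_path_three <;> simp [starTree, parentGraph_adj, starParent]
  · refine Or.inr (Or.inl (starTree_inSStarFamily _ _ _ ![0, 1, 2, 3] (by simp) (by simp)
      fun i => ?_))
    fin_cases i
    · rw [hset2 _ 0 (by decide)]
      apply isLeafCopy_path_two; simp [starTree, parentGraph_adj, starParent]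
    · rw [hset2 _ 1 (by decide)]
      apply isLeafCopy_path_two; simp [starTree, parentGraph_adj, starParent]
    · rw [hset2 _ 2 (by decide)]
      apply isLeafCopy_path_two; simp [starTree, parentGraph_adj, starParent]
    · rw [hset2 _ 3 (by decide)]
      apply isLeafCopy_path_two; simp [starTree, parentGraph_adj, starParent]
  · refine Or.inr (Or.inr (starTree_inSStarFamily _ _ _ ![0, 0, 1, 2] (by simp) (by simp)
      fun i => ?_))
    fin_cases i
    · rw [hset3 _ 0 1 (by decide)]
      apply isLeafCopy_path_three <;> simp [starTree, parentGraph_adj, starParent]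
    · rw [hset2 _ 2 (by decide)]
      apply isLeafCopy_path_two; simp [starTree, parentGraph_adj, starParent]
    · rw [hset2 _ 3 (by decide)]
      apply isLeafCopy_path_two; simp [starTree, parentGraph_adj, starParent]

theorem InExtremalSStarFamilies.of_iso {V W : Type*} {G : SimpleGraph V} {H : SimpleGraph W}
    {k : ℕ} (φ : G ≃g H) (h : InExtremalSStarFamilies H k) : InExtremalSStarFamilies G k := by
  rcases h with ⟨T, h1, h2⟩ | ⟨T, h1, h2⟩ | ⟨T, h1, h2⟩
  · exact Or.inl ⟨T, h1, h2.of_iso φ⟩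
  · exact Or.inr (Or.inl ⟨T, h1, h2.of_iso φ⟩)
  · exact Or.inr (Or.inr ⟨T, h1, h2.of_iso φ⟩)

theorem exists_of_isLeaf_path_two {V : Type*} {G : SimpleGraph V} {W : Set V} {v : V} (hv : v ∈ W)
    (φ : Nonempty (G.induce W ≃g (pathFinGraph 2).2)) :
    ∃ a ∈ W, a ≠ v ∧ G.Adj v a := by
  obtain ⟨φ⟩ := φ
  change G.induce W ≃g SimpleGraph.pathGraph 2 at φ
  have key : ∀ z : Fin 2, ∃ a, (SimpleGraph.pathGraph 2).Adj z a := by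
    simp only [SimpleGraph.pathGraph_adj]; decide
  obtain ⟨a, ha⟩ := key (φ ⟨v, hv⟩)
  obtain ⟨a, rfl⟩ := φ.surjective a
  have ha' : G.Adj v a := φ.map_adj_iff.1 ha
  exact ⟨a, a.2, ha'.ne', ha'⟩

/-- Being a leaf excludes that `v` is the middle of the path. -/
theorem exists_of_isLeaf_path_three {V : Type*} {G : SimpleGraph V} {W : Set V} {v : V}
    (hv : v ∈ W) (φ : Nonempty (G.induce W ≃g (pathFinGraph 3).2))
    (hl : IsLeaf (G.induce W) ⟨v, hv⟩) :
    ∃ a ∈ W, ∃ b ∈ W, a ≠ v ∧ b ≠ v ∧ a ≠ b ∧ G.Adj v a ∧ G.Adj a b := by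
  obtain ⟨φ⟩ := φ
  change G.induce W ≃g SimpleGraph.pathGraph 3 at φ
  have key : ∀ z : Fin 3, (∃ u, (SimpleGraph.pathGraph 3).Adj z u ∧
      ∀ w, (SimpleGraph.pathGraph 3).Adj z w → w = u) → ∃ a b, (SimpleGraph.pathGraph 3).Adj z a ∧
      (SimpleGraph.pathGraph 3).Adj a b ∧ b ≠ z := by
    simp only [SimpleGraph.pathGraph_adj]; decide
  obtain ⟨a, b, ha, hab, hb⟩ := key (φ ⟨v, hv⟩) (isLeaf_iff.1 (hl.map_iso φ))
  obtain ⟨a, rfl⟩ := φ.surjective a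
  obtain ⟨b, rfl⟩ := φ.surjective b
  have ha' : G.Adj v a := φ.map_adj_iff.1 ha
  have hab' : G.Adj a b := φ.map_adj_iff.1 hab
  exact ⟨a, a.2, b, b.2, ha'.ne', fun h => hb (congrArg φ (Subtype.ext h)), hab'.ne, ha', hab'⟩

/-- The vertices `a 0, a 1, a 2` form with `v` a path starting at `v` if `b` holds, and a claw with
leaf `v` otherwise. -/
def IsAttached {V : Type*} (G : SimpleGraph V) (v : V) (a : Fin 3 → V) (b : Bool) : Prop :=
  G.Adj (a 0) (a 1) ∧ G.Adj (a 1) (a 2) ∧ G.Adj v (a (if b then 0 else 1))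

theorem exists_of_isP4OrK13 {V : Type*} {G : SimpleGraph V} {W : Set V} {v : V}
    (hv : v ∈ W) {T : FinGraph} (hT : IsP4OrK13 T) (φ : Nonempty (G.induce W ≃g T.2))
    (hl : IsLeaf (G.induce W) ⟨v, hv⟩) :
    ∃ (a : Fin 3 → V) (b : Bool), (∀ j, a j ∈ W ∧ a j ≠ v) ∧ a.Injective ∧ IsAttached G v a b := by
  obtain ⟨φ⟩ := φ
  have lift : ∀ {X : Type} (H : SimpleGraph X) (ψ : G.induce W ≃g H) (c : Fin 3 → X) (b : Bool),
      c.Injective → (∀ j, c j ≠ ψ ⟨v, hv⟩) → H.Adj (c 0) (c 1) → H.Adj (c 1) (c 2) →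
      H.Adj (ψ ⟨v, hv⟩) (c (if b then 0 else 1)) →
      ∃ (a : Fin 3 → V) (b : Bool), (∀ j, a j ∈ W ∧ a j ≠ v) ∧ a.Injective ∧
        IsAttached G v a b := by
    intro X H ψ c b hc hne h1 h2 h3
    have hadj : ∀ x y, H.Adj x y → G.Adj (ψ.symm x).1 (ψ.symm y).1 := fun x y h =>
      ψ.symm.map_adj_iff.2 h
    refine ⟨fun j => (ψ.symm (c j)).1, b, fun j => ⟨(ψ.symm (c j)).2, fun h => hne j ?_⟩,
      fun i j h => hc (ψ.symm.injective (Subtype.ext h)), hadj _ _ h1, hadj _ _ h2, ?_⟩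
    · rw [← ψ.apply_symm_apply (c j)]
      exact congrArg ψ (Subtype.ext h)
    · simpa using hadj _ _ h3
  rcases hT with ⟨⟨ψ⟩⟩ | ⟨⟨ψ⟩⟩
  · have hl' := isLeaf_iff.1 (hl.map_iso (φ.trans ψ))
    have key : ∀ z : Fin 4, (∃ u, (SimpleGraph.pathGraph 4).Adj z u ∧
        ∀ w, (SimpleGraph.pathGraph 4).Adj z w → w = u) → z = 0 ∨ z = 3 := by
      simp only [SimpleGraph.pathGraph_adj]; decide
    rcases key _ hl' with h | h
    · refine lift _ (φ.trans ψ) ![1, 2, 3] true (by decide) ?_ ?_ ?_ ?_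
      · rw [h]; decide
      · simp [SimpleGraph.pathGraph_adj]
      · simp [SimpleGraph.pathGraph_adj]
      · rw [h]; simp [SimpleGraph.pathGraph_adj]
    · refine lift _ (φ.trans ψ) ![2, 1, 0] true (by decide) ?_ ?_ ?_ ?_
      · rw [h]; decide
      · simp [SimpleGraph.pathGraph_adj]
      · simp [SimpleGraph.pathGraph_adj]
      · rw [h]; simp [SimpleGraph.pathGraph_adj]
  · have hl' := isLeaf_iff.1 (hl.map_iso (φ.trans ψ))
    rcases hz : (φ.trans ψ) ⟨v, hv⟩ with z | z
    · rw [hz] at hl'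
      obtain ⟨u, -, hu⟩ := hl'
      have := (hu (Sum.inr 0) (by simp)).trans (hu (Sum.inr 1) (by simp)).symm
      simp at this
    -- In `Fin 3`, `z + 1` and `z + 2` are the two leaves of the claw other than `z`.
    · refine lift _ (φ.trans ψ) ![Sum.inr (z + 1), Sum.inl 0, Sum.inr (z + 2)] false ?_ ?_ ?_ ?_ ?_
      · clear hz; revert z; decide
      · rw [hz]; intro j; fin_cases j <;> simp
      · simp
      · simp
      · rw [hz]; simp

/-- Only the edges to parents have to be exhibited: the injection is a bijection by `hcard`, and a
tree has no room for further edges. -/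
theorem SimpleGraph.IsTree.nonempty_iso_starTree {V : Type*} [Fintype V] {G : SimpleGraph V}
    (hG : G.IsTree) {k : ℕ} (hcard : Fintype.card V = 3 * k + 5) (v : V) (c : Fin 4 → V)
    (a : Fin k → Fin 3 → V) (t : Fin 3) (b : Fin k → Bool)
    (hinj : Function.Injective (fun x : StarVertex k => x.elim v (Sum.elim c fun y => a y.1 y.2)))
    (h0 : G.Adj v (c 0)) (h2 : G.Adj v (c 2))
    (h1 : if t = 1 then G.Adj v (c 1) else G.Adj (c 0) (c 1))
    (h3 : if t = 0 then G.Adj (c 2) (c 3) else G.Adj v (c 3))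
    (ha : ∀ i, IsAttached G v (a i) (b i)) : Nonempty (G ≃g starTree t b) := by
  refine hG.nonempty_iso_parentGraph none rfl (fun x => ⟨3, starParent_iterate t b x⟩) hinj
    (by rw [hcard, card_starVertex]) ?_
  rintro (_ | j | ⟨i, j⟩) hx
  · exact absurd rfl hx
  · fin_cases j
    · exact h0.symm
    · by_cases ht : t = 1
      · simpa [starParent, ht] using (by simpa [ht] using h1 : G.Adj v (c 1)).symm
      · simpa [starParent, ht] using (by simpa [ht] using h1 : G.Adj (c 0) (c 1)).symm
    · exact h2.symm
    · by_cases ht : t = 0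
      · simpa [starParent, ht] using (by simpa [ht] using h3 : G.Adj (c 2) (c 3)).symm
      · simpa [starParent, ht] using (by simpa [ht] using h3 : G.Adj v (c 3)).symm
  · obtain ⟨h01, h12, hv⟩ := ha i
    by_cases hb : b i
    · simp only [hb, if_true] at hv
      fin_cases j
      · simpa [starParent, hb] using hv.symm
      · simpa [starParent, hb] using h01.symm
      · simpa [starParent, hb] using h12.symm
    · simp only [hb] at hv
      fin_cases j
      · simpa [starParent, hb] using h01
      · simpa [starParent, hb] using hv.symm
      · simpa [starParent, hb] using h12.symm

/-- Here `d` names the piece supplying each of the four central vertices, and `hA` extracts them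
from the pieces `A`. Distinct pieces meet only in `v`, hence injectivity need be checked only within
a piece. -/
theorem InSStarFamily.nonempty_iso_starTree {V : Type*} [Fintype V] {G : SimpleGraph V}
    (hG : G.IsTree) {k n : ℕ} (hcard : Fintype.card V = 3 * k + 5) {A : Fin n → FinGraph}
    (h : InSStarFamily G A k) (t : Fin 3) (d : Fin 4 → Fin n)
    (hA : ∀ (v : V) (W : Fin n → Set V) (hv : ∀ i, v ∈ W i),
      (∀ i, Nonempty (G.induce (W i) ≃g (A i).2)) → (∀ i, IsLeaf (G.induce (W i)) ⟨v, hv i⟩) →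
      ∃ c : Fin 4 → V, (∀ j, c j ∈ W (d j) ∧ c j ≠ v) ∧ (∀ j j', d j = d j' → c j = c j' → j = j') ∧
        G.Adj v (c 0) ∧ G.Adj v (c 2) ∧ (if t = 1 then G.Adj v (c 1) else G.Adj (c 0) (c 1)) ∧
        (if t = 0 then G.Adj (c 2) (c 3) else G.Adj v (c 3))) :
    ∃ b : Fin k → Bool, Nonempty (G ≃g starTree t b) := by
  obtain ⟨T, hT, v, W, hv, hiso, hleaf, hdisj, -, -⟩ := h
  obtain ⟨c, hc, hcinj, h0, h2, h1, h3⟩ := hA v (fun i => W (Sum.inl i)) (fun i => hv _)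
    (fun i => hiso (Sum.inl i)) (fun i => hleaf (Sum.inl i))
  have := fun i => exists_of_isP4OrK13 (hv (Sum.inr i)) (hT i) (hiso (Sum.inr i))
    (hleaf (Sum.inr i))
  choose a b ha hainj hatt using this
  refine ⟨b, hG.nonempty_iso_starTree hcard v c a t b ?_ h0 h2 h1 h3 hatt⟩
  have hW : ∀ i j x, x ∈ W i → x ∈ W j → x ≠ v → i = j := fun i j x hi hj hx => by
    by_contra hij
    have : x ∈ W i ∩ W j := ⟨hi, hj⟩
    rw [hdisj i j hij] at this
    exact hx this
  rintro (_ | j | ⟨i, j⟩) (_ | j' | ⟨i', j'⟩) h <;> simp only [Option.elim, Sum.elim_inl,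
    Sum.elim_inr] at h
  · rfl
  · exact absurd h.symm (hc j').2
  · exact absurd h.symm (ha i' j').2
  · exact absurd h (hc j).2
  · have := hW _ _ _ (hc j).1 (h ▸ (hc j').1) (hc j).2
    rw [hcinj j j' (Sum.inl.inj this) h]
  · have := hW _ _ _ (hc j).1 (h ▸ (ha i' j').1) (hc j).2
    simp at this
  · exact absurd h (ha i j).2
  · have := hW _ _ _ (ha i j).1 (h ▸ (hc j').1) (ha i j).2
    simp at this
  · obtain rfl := Sum.inr.inj (hW _ _ _ (ha i j).1 (h ▸ (ha i' j').1) (ha i j).2)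
    rw [hainj i h]

theorem InExtremalSStarFamilies.nonempty_iso_starTree {V : Type*} [Fintype V] {G : SimpleGraph V}
    (hG : G.IsTree) {k : ℕ} (hcard : Fintype.card V = 3 * k + 5)
    (h : InExtremalSStarFamilies G k) :
    ∃ (t : Fin 3) (b : Fin k → Bool), Nonempty (G ≃g starTree t b) := by
  rcases h with h | h | h
  · refine ⟨0, h.nonempty_iso_starTree hG hcard 0 ![0, 0, 1, 1] fun v W hv hiso hleaf => ?_⟩
    obtain ⟨a, ha, b, hb, h1, h2, h3, h4, h5⟩ :=
      exists_of_isLeaf_path_three (hv 0) (hiso 0) (hleaf 0)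
    obtain ⟨a', ha', b', hb', h1', h2', h3', h4', h5'⟩ :=
      exists_of_isLeaf_path_three (hv 1) (hiso 1) (hleaf 1)
    refine ⟨![a, b, a', b'], ?_, ?_, h4, h4', ?_, ?_⟩
    · intro j; fin_cases j <;> simp [*]
    · intro j j'; fin_cases j <;> fin_cases j' <;> simp [*, h3.symm, h3'.symm]
    · simpa using h5
    · simpa using h5'
  · refine ⟨1, h.nonempty_iso_starTree hG hcard 1 ![0, 1, 2, 3] fun v W hv hiso hleaf => ?_⟩
    obtain ⟨a0, ha0, h0, hv0⟩ := exists_of_isLeaf_path_two (hv 0) (hiso 0)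
    obtain ⟨a1, ha1, h1, hv1⟩ := exists_of_isLeaf_path_two (hv 1) (hiso 1)
    obtain ⟨a2, ha2, h2, hv2⟩ := exists_of_isLeaf_path_two (hv 2) (hiso 2)
    obtain ⟨a3, ha3, h3, hv3⟩ := exists_of_isLeaf_path_two (hv 3) (hiso 3)
    refine ⟨![a0, a1, a2, a3], ?_, ?_, hv0, hv2, ?_, ?_⟩
    · intro j; fin_cases j <;> simp [*]
    · intro j j'; fin_cases j <;> fin_cases j' <;> simp
    · simpa using hv1
    · simpa using hv3
  · refine ⟨2, h.nonempty_iso_starTree hG hcard 2 ![0, 0, 1, 2] fun v W hv hiso hleaf => ?_⟩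
    obtain ⟨a, ha, b, hb, h1, h2, h3, h4, h5⟩ :=
      exists_of_isLeaf_path_three (hv 0) (hiso 0) (hleaf 0)
    obtain ⟨a2, ha2, h2', hv2⟩ := exists_of_isLeaf_path_two (hv 1) (hiso 1)
    obtain ⟨a3, ha3, h3', hv3⟩ := exists_of_isLeaf_path_two (hv 2) (hiso 2)
    refine ⟨![a, b, a2, a3], ?_, ?_, h4, hv2, ?_, ?_⟩
    · intro j; fin_cases j <;> simp [*]
    · intro j j'; fin_cases j <;> fin_cases j' <;> simp [*, h3.symm]
    · simpa using h5
    · simpa using hv3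

/-! ### Restrictions on the covering choices -/

theorem card_choices_le_one {ι : Type*} [Fintype ι] {S : Finset (ι → Fin 3)} (i : ι)
    (A : Finset (Fin 3)) (h : ∀ x ∈ S, x i ∈ A) : S.card ≤ A.card * 3 ^ (Fintype.card ι - 1) := by
  simpa using card_choices_le S (fun _ : Fin 1 => i) (Function.injective_of_subsingleton _)
    (fun a => a 0) (fun a b h => by funext k; rwa [Subsingleton.elim k 0]) A h

theorem card_choices_le_two {ι : Type*} [Fintype ι] {S : Finset (ι → Fin 3)} {i j : ι}
    (hij : i ≠ j) (A : Finset (Fin 3 × Fin 3)) (h : ∀ x ∈ S, (x i, x j) ∈ A) :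
    S.card ≤ A.card * 3 ^ (Fintype.card ι - 2) := by
  simpa using card_choices_le S ![i, j]
    (by intro a b; fin_cases a <;> fin_cases b <;> simp [hij, hij.symm])
    (fun a => (a 0, a 1)) (fun a b h => by
      funext k; fin_cases k <;> simp_all) A h

theorem card_choices_le_three {ι : Type*} [Fintype ι] {S : Finset (ι → Fin 3)} {i j l : ι}
    (hij : i ≠ j) (hil : i ≠ l) (hjl : j ≠ l) (A : Finset (Fin 3 × Fin 3 × Fin 3))
    (h : ∀ x ∈ S, (x i, x j, x l) ∈ A) : S.card ≤ A.card * 3 ^ (Fintype.card ι - 3) := by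
  simpa using card_choices_le S ![i, j, l]
    (by intro a b; fin_cases a <;> fin_cases b <;>
          simp [hij, hij.symm, hil, hil.symm, hjl, hjl.symm])
    (fun a => (a 0, a 1, a 2)) (fun a b h => by
      funext k; fin_cases k <;> simp_all) A h

/-- Exactly `3 ^ (|ι| - 1)` words have value `s` at `i`, so `S` contains all of them; one more would
violate `card_choices_le_one`. -/
theorem mem_of_card_choices_eq {ι : Type*} [Fintype ι] {S : Finset (ι → Fin 3)} {i : ι}
    {s : Fin 3} (h : ∀ x ∈ S, x i = s) (hcard : 3 ^ (Fintype.card ι - 1) ≤ S.card)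
    {x : ι → Fin 3} (hx : x i = s) : x ∈ S := by
  classical
  have h1 := card_choices_le_one (S := insert x S) i {s} (by
    intro y hy
    rcases Finset.mem_insert.1 hy with rfl | hy
    exacts [by simp [hx], by simp [h y hy]])
  by_contra hxS
  rw [Finset.card_insert_of_notMem hxS, Finset.card_singleton] at h1
  omega

theorem IsPathFamily.ne {V ι : Type*} {G : SimpleGraph V} {q : ι → Fin 3 → V}
    (hq : IsPathFamily G q) {i : ι} {j j' : Fin 3} (h : j ≠ j') : q i j ≠ q i j' :=
  fun h' => h (hq.inj _ _ _ _ h').2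

theorem IsPathFamily.ne_of_ne {V ι : Type*} {G : SimpleGraph V} {q : ι → Fin 3 → V}
    (hq : IsPathFamily G q) {i i' : ι} {j j' : Fin 3} (h : i ≠ i') : q i j ≠ q i' j' :=
  fun h' => h (hq.inj _ _ _ _ h').1

theorem IsPathFamily.adj {V ι : Type*} {G : SimpleGraph V} {q : ι → Fin 3 → V}
    (hq : IsPathFamily G q) (i : ι) {j j' : Fin 3} (h : j ≠ j') (h' : j = 1 ∨ j' = 1) :
    G.Adj (q i j) (q i j') := by
  have h1 := hq.adj01 i
  have h2 := hq.adj12 i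
  have h3 := h1.symm
  have h4 := h2.symm
  fin_cases j <;> fin_cases j' <;> simp_all

section Constraints

variable {V ι : Type*} [Fintype ι] [DecidableEq V] {G : SimpleGraph V} {q : ι → Fin 3 → V}

/-- If `w` hangs at an end `j`, the path through `w`, that end and the middle must be hit. If it
hangs at the middle, two such paths exist, one per end, and only the middle hits both. -/
theorem IsPathFamily.eq_or_of_adj_uncovered (hq : IsPathFamily G q) {x : ι → Fin 3}
    (hx : x ∈ coveringChoices G q) {w : V} (hw : ∀ i j, q i j ≠ w) {i : ι} {j : Fin 3}
    (h : G.Adj w (q i j)) : x i = 1 ∨ (j ≠ 1 ∧ x i = j) := by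
  rw [mem_coveringChoices] at hx
  have key : ∀ k, k ≠ j → (j = 1 ∨ k = 1) → x i = j ∨ x i = k := fun k hk hjk => by
    have := hx w _ _ h (hq.adj i hk.symm hjk) (hw i k).symm
    rw [hq.mem_transversal, hq.mem_transversal] at this
    exact this.resolve_left (notMem_transversal hw x)
  clear h
  revert key
  generalize x i = a
  revert a j
  decide

theorem IsPathFamily.eq_of_adj_uncovered_pair (hq : IsPathFamily G q) {x : ι → Fin 3}
    (hx : x ∈ coveringChoices G q) {w w' : V} (hw : ∀ i j, q i j ≠ w) (hw' : ∀ i j, q i j ≠ w')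
    (hne : w ≠ w') {i : ι} {j : Fin 3} (h : G.Adj w (q i j)) (h' : G.Adj w' (q i j)) :
    x i = j := by
  rw [mem_coveringChoices] at hx
  have := hx _ _ _ h h'.symm hne
  rw [hq.mem_transversal] at this
  have h1 := notMem_transversal hw x
  have h2 := notMem_transversal hw' x
  tauto

theorem IsPathFamily.eq_of_adj_uncovered_adj (hq : IsPathFamily G q) {x : ι → Fin 3}
    (hx : x ∈ coveringChoices G q) {w w' : V} (hw : ∀ i j, q i j ≠ w) (hw' : ∀ i j, q i j ≠ w')
    (hne : G.Adj w' w) {i : ι} {j : Fin 3} (h : G.Adj w (q i j)) : x i = j := by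
  rw [mem_coveringChoices] at hx
  have := hx _ _ _ hne h (hw' i j).symm
  rw [hq.mem_transversal] at this
  have h1 := notMem_transversal hw x
  have h2 := notMem_transversal hw' x
  tauto

/-- If the endpoint `q i' p'` is not chosen, the edge acts on path `i` like a second pendant vertex.
At the end `j` it forms a path with `w` that forces `j`; at the middle it forces `1`; at the far end
it allows `1` and `p`, of which `w` permits only `1`. -/
theorem IsPathFamily.eq_or_of_adj (hq : IsPathFamily G q) {x : ι → Fin 3}
    (hx : x ∈ coveringChoices G q) {w : V} (hw : ∀ i j, q i j ≠ w) {i i' : ι} (hi : i ≠ i')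
    {j p p' : Fin 3} (h : G.Adj w (q i j)) (hj : j ≠ 1) (hp : G.Adj (q i p) (q i' p')) :
    x i = (if p = j then j else 1) ∨ x i' = p' := by
  have h1 := hq.eq_or_of_adj_uncovered hx hw h
  rw [mem_coveringChoices] at hx
  have h2 : p = j → x i = j ∨ x i' = p' := by
    rintro rfl
    have := hx _ _ _ h hp (hw i' p').symm
    rw [hq.mem_transversal, hq.mem_transversal] at this
    exact this.resolve_left (notMem_transversal hw x)
  have h3 : ∀ k, k ≠ p → (k = 1 ∨ p = 1) → x i = k ∨ x i = p ∨ x i' = p' := fun k hk hkp => by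
    have := hx _ _ _ (hq.adj i hk hkp) hp (hq.ne_of_ne hi)
    rwa [hq.mem_transversal, hq.mem_transversal, hq.mem_transversal] at this
  clear h hp hw hx
  revert h1 h2 h3
  generalize x i = a
  generalize x i' = b
  revert a b j p p'
  decide

/-- A third path adjacent to `w` or to the path at which `w` is attached makes the number of
covering choices drop. -/
theorem IsPathFamily.card_coveringChoices_lt (hq : IsPathFamily G q) {w : V}
    (hw : ∀ i j, q i j ≠ w) {i i' l : ι} (hi : i ≠ i') (hil : i ≠ l) (hl : i' ≠ l) {j j' : Fin 3}
    (h : G.Adj w (q i j)) (hj : j ≠ 1) (hj' : ∀ x ∈ coveringChoices G q, x i' = 1 ∨ x i' = j')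
    (hadj : (∃ p, G.Adj w (q l p)) ∨ ∃ p p', G.Adj (q i p) (q l p')) :
    (coveringChoices G q).card < 3 ^ (Fintype.card ι - 1) := by
  classical
  have hcard : 3 ≤ Fintype.card ι := by
    have := Finset.card_le_univ ({i, i', l} : Finset ι)
    rwa [Finset.card_eq_three.2 ⟨i, i', l, hi, hil, hl, rfl⟩] at this
  -- If `w` meets path `l`, there are `2 * 2 * 2` triples. If path `i` meets path `l`, one of the
  -- two values at `i` leaves three values at `l` and the other only `p'`, giving `(3 + 1) * 2`.
  -- Equality would need nine.
  obtain ⟨A, hA, hmem⟩ : ∃ A : Finset (Fin 3 × Fin 3 × Fin 3), A.card ≤ 8 ∧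
      ∀ x ∈ coveringChoices G q, (x i, x i', x l) ∈ A := by
    rcases hadj with ⟨p, hp⟩ | ⟨p, p', hp⟩
    · refine ⟨({1, j} : Finset (Fin 3)) ×ˢ ({1, j'} : Finset (Fin 3)) ×ˢ
        ({1, p} : Finset (Fin 3)), ?_, fun x hx => ?_⟩
      · rw [Finset.card_product, Finset.card_product]
        exact Nat.mul_le_mul Finset.card_le_two (Nat.mul_le_mul Finset.card_le_two
          Finset.card_le_two)
      · have h1 := hq.eq_or_of_adj_uncovered hx hw h
        have h2 := hq.eq_or_of_adj_uncovered hx hw hp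
        have h3 := hj' x hx
        simp only [Finset.mem_product, Finset.mem_insert, Finset.mem_singleton]
        tauto
    · refine ⟨Finset.univ.filter fun a => (a.1 = 1 ∨ a.1 = j) ∧ (a.2.1 = 1 ∨ a.2.1 = j') ∧
        (a.1 = (if p = j then j else 1) ∨ a.2.2 = p'), ?_, fun x hx => ?_⟩
      · clear h hj' hp
        revert j j' p p'
        decide
      · have h1 := hq.eq_or_of_adj_uncovered hx hw h
        have h2 := hq.eq_or_of_adj hx hw hil h hj hp
        have h3 := hj' x hx
        simp only [Finset.mem_filter, Finset.mem_univ, true_and]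
        tauto
  have h1 := card_choices_le_three hi hil hl A hmem
  calc _ ≤ A.card * 3 ^ (Fintype.card ι - 3) := h1
    _ ≤ 8 * 3 ^ (Fintype.card ι - 3) := Nat.mul_le_mul_right _ hA
    _ < 9 * 3 ^ (Fintype.card ι - 3) := Nat.mul_lt_mul_of_pos_right (by norm_num) (by positivity)
    _ = 3 ^ (Fintype.card ι - 1) := by
      rw [show (9 : ℕ) = 3 ^ 2 by norm_num, ← pow_add]; congr 1; omega

theorem IsPathFamily.card_range [Fintype V] (hq : IsPathFamily G q) :
    (Finset.univ.image fun y : ι × Fin 3 => q y.1 y.2).card = 3 * Fintype.card ι := by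
  rw [Finset.card_image_of_injective _ fun a b h => Prod.ext (hq.inj _ _ _ _ h).1
    (hq.inj _ _ _ _ h).2]
  simp [mul_comm]

end Constraints

theorem SimpleGraph.Connected.card_le_two {V : Type*} [Fintype V] {G : SimpleGraph V}
    (hG : G.Connected) (h : IsPathCover G ∅) : Fintype.card V ≤ 2 := by
  classical
  by_contra! hc
  obtain ⟨a⟩ := hG.nonempty
  have hex : ∀ S : Finset V, S.card ≤ 2 → ∃ b, b ∉ S := fun S hS => by
    by_contra! hall
    have := Finset.card_le_card (fun x _ => hall x : Finset.univ ⊆ S)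
    rw [Finset.card_univ] at this
    omega
  obtain ⟨b, hb⟩ := hex {a} (by simp)
  obtain ⟨x, hx, y, hy, hxy⟩ := hG.exists_adj_mem_notMem {a} rfl (by simpa using hb : b ∉ ({a} : Set V))
  obtain rfl : x = a := hx
  obtain ⟨c, hc⟩ := hex {x, y} Finset.card_le_two
  obtain ⟨z, hz, z', hz', hzz⟩ := hG.exists_adj_mem_notMem {x, y} (Or.inl rfl)
    (by simpa using hc : c ∉ ({x, y} : Set V))
  simp only [Set.mem_insert_iff, Set.mem_singleton_iff, not_or] at hz hz'
  rcases hz with rfl | rfl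
  · simpa using h y z z' hxy.symm hzz (Ne.symm hz'.2)
  · simpa using h x z z' hxy hzz (Ne.symm hz'.1)

theorem IsPathFamily.card_coveringChoices_lt_of_card_lt {V ι : Type*} [Fintype V] [Fintype ι]
    [DecidableEq V] {G : SimpleGraph V} {q : ι → Fin 3 → V} (hG : G.Connected)
    (hq : IsPathFamily G q) {m : ℕ} (hcard : Fintype.card V = 3 * m + 2)
    (hlt : Fintype.card ι < m) : (coveringChoices G q).card < 3 ^ (m - 1) := by
  rcases isEmpty_or_nonempty ι with hι | ⟨⟨i₀⟩⟩
  · have : coveringChoices G q = ∅ := by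
      refine Finset.eq_empty_of_forall_notMem fun x hx => ?_
      rw [mem_coveringChoices, show transversal q x = ∅ by simp [transversal]] at hx
      have := hG.card_le_two hx
      omega
    rw [this]
    simp
  · have hr := hq.card_range
    obtain ⟨w₀, hw₀⟩ : ∃ w, w ∉ (Finset.univ.image fun y : ι × Fin 3 => q y.1 y.2) := by
      by_contra! hall
      rw [Finset.eq_univ_of_forall hall, Finset.card_univ] at hr
      omega
    -- By connectedness some vertex outside all paths is adjacent to one of them; that path keeps
    -- two of its three choices.
    obtain ⟨x, ⟨⟨i, j⟩, rfl⟩, w, hw, hadj⟩ := hG.exists_adj_mem_notMem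
      (Set.range fun y : ι × Fin 3 => q y.1 y.2) ⟨(i₀, 0), rfl⟩ (by simpa using hw₀)
    have hw' : ∀ i j, q i j ≠ w := fun i j h => hw ⟨(i, j), h⟩
    have h1 := card_choices_le_one (S := coveringChoices G q) i {1, j} (fun x hx => by
      have := hq.eq_or_of_adj_uncovered hx hw' hadj.symm
      simp only [Finset.mem_insert, Finset.mem_singleton]
      tauto)
    have h2 : 0 < Fintype.card ι := Fintype.card_pos_iff.2 ⟨i₀⟩
    calc _ ≤ _ := h1
      _ ≤ 2 * 3 ^ (Fintype.card ι - 1) := Nat.mul_le_mul_right _ Finset.card_le_two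
      _ < 3 * 3 ^ (Fintype.card ι - 1) := Nat.mul_lt_mul_of_pos_right (by norm_num) (by positivity)
      _ = 3 ^ Fintype.card ι := by rw [← pow_succ']; congr 1; omega
      _ ≤ 3 ^ (m - 1) := Nat.pow_le_pow_right (by norm_num) (by omega)

/-! ### A forced coordinate yields an extremal tree -/

/-- A matching on four vertices attached to `v` extends `v` in one of the three central shapes. -/
theorem SimpleGraph.Connected.exists_central_shape {V : Type*} [DecidableEq V]
    {G : SimpleGraph V} (hG : G.Connected) {v : V} {L : Finset V} (hL : L.card = 4) (hv : v ∉ L)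
    (hcl : ∀ y ∈ L, ∀ z, G.Adj y z → z = v ∨ z ∈ L)
    (hm : ∀ a ∈ L, ∀ b ∈ L, ∀ c ∈ L, G.Adj a b → G.Adj b c → a = c) :
    ∃ (c : Fin 4 → V) (t : Fin 3), c.Injective ∧ (∀ j, c j ∈ L) ∧ G.Adj v (c 0) ∧ G.Adj v (c 2) ∧
      (if t = 1 then G.Adj v (c 1) else G.Adj (c 0) (c 1)) ∧
      (if t = 0 then G.Adj (c 2) (c 3) else G.Adj v (c 3)) := by
  -- A component of the matching can leave `L` only through `v`, so by connectedness one of its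
  -- vertices is adjacent to `v`.
  have hnear : ∀ u ∈ L, G.Adj v u ∨ ∃ u' ∈ L, G.Adj u u' ∧ G.Adj v u' := by
    intro u hu
    obtain ⟨x, hx, y, hy, hxy⟩ := hG.exists_adj_mem_notMem {x | x = u ∨ (x ∈ L ∧ G.Adj u x)}
      (Or.inl rfl) (b := v) (by
        rintro (rfl | h)
        exacts [hv hu, hv h.1])
    simp only [Set.mem_ofPred_eq, not_or, not_and] at hx hy
    rcases hx with rfl | ⟨hxL, hux⟩
    · rcases hcl x hu y hxy with rfl | hyL
      · exact Or.inl hxy.symm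
      · exact absurd hxy (hy.2 hyL)
    · rcases hcl x hxL y hxy with rfl | hyL
      · exact Or.inr ⟨x, hxL, hux, hxy.symm⟩
      · exact absurd (hm u hu x hxL y hyL hux hxy).symm hy.1
  have hinj : ∀ a b c d : V, ({a, b, c, d} : Finset V) = L →
      Function.Injective ![a, b, c, d] ∧ ∀ j, ![a, b, c, d] j ∈ L := by
    rintro a b c d rfl
    refine ⟨?_, fun j => by fin_cases j <;> simp⟩
    have himg : Finset.univ.image ![a, b, c, d] = {a, b, c, d} := by
      ext y
      simp [Fin.exists_fin_succ, eq_comm]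
    rw [← Set.injOn_univ, ← Finset.coe_univ, ← Finset.card_image_iff, himg, hL]
    rfl
  -- The number of edges inside `L` decides the shape: two give `t = 0`, one gives `t = 2`, none
  -- gives `t = 1`.
  by_cases hE : ∃ x ∈ L, ∃ y ∈ L, G.Adj x y
  · obtain ⟨x, hx, y, hy, hxy, hvx⟩ : ∃ x ∈ L, ∃ y ∈ L, G.Adj x y ∧ G.Adj v x := by
      obtain ⟨x, hx, y, hy, hxy⟩ := hE
      rcases hnear x hx with h | ⟨u, hu, hxu, hvu⟩
      · exact ⟨x, hx, y, hy, hxy, h⟩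
      · exact ⟨u, hu, x, hx, hxu.symm, hvu⟩
    have hxyc : ((L.erase x).erase y).card = 2 := by
      rw [Finset.card_erase_of_mem (Finset.mem_erase.2 ⟨hxy.ne', hy⟩), Finset.card_erase_of_mem hx,
        hL]
    obtain ⟨z, w, hzw, hzwL⟩ := Finset.card_eq_two.1 hxyc
    have hLeq : L = {x, y, z, w} := by
      rw [← Finset.insert_erase hx, ← Finset.insert_erase (Finset.mem_erase.2 ⟨hxy.ne', hy⟩),
        hzwL]
    have hz : z ∈ L := by simp [hLeq]
    have hw : w ∈ L := by simp [hLeq]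
    have hzn : z ≠ x ∧ z ≠ y := by
      have : z ∈ (L.erase x).erase y := by simp [hzwL]
      simp only [Finset.mem_erase] at this
      tauto
    have hwn : w ≠ x ∧ w ≠ y := by
      have : w ∈ (L.erase x).erase y := by simp [hzwL]
      simp only [Finset.mem_erase] at this
      tauto
    have hfar : ∀ u ∈ L, u ≠ x → u ≠ y → ∀ u' ∈ L, G.Adj u u' → u' ≠ x ∧ u' ≠ y := by
      intro u hu hux huy u' hu' h
      constructor
      · rintro rfl
        exact huy (hm u hu u' hx y hy h hxy)
      · rintro rfl
        exact hux (hm u hu u' hy x hx h hxy.symm)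
    have hcase : ∀ u ∈ L, u = x ∨ u = y ∨ u = z ∨ u = w := fun u hu => by
      rw [hLeq] at hu
      simpa using hu
    by_cases hzwE : G.Adj z w
    · obtain ⟨z, w, hzw', hvz, hLeq⟩ : ∃ z w, G.Adj z w ∧ G.Adj v z ∧ L = {x, y, z, w} := by
        rcases hnear z hz with h | ⟨u, hu, hzu, hvu⟩
        · exact ⟨z, w, hzwE, h, hLeq⟩
        · obtain rfl : u = w := by
            have := hfar z hz hzn.1 hzn.2 u hu hzu
            have := hzu.ne'
            have := hcase u hu
            tauto
          exact ⟨u, z, hzu.symm, hvu, by rw [hLeq, Finset.pair_comm z u]⟩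
      obtain ⟨h1, h2⟩ := hinj _ _ _ _ hLeq.symm
      exact ⟨_, 0, h1, h2, hvx, hvz, by simpa using hxy, by simpa using hzw'⟩
    · obtain ⟨h1, h2⟩ := hinj _ _ _ _ hLeq.symm
      have hiso : ∀ u ∈ L, u ≠ x → u ≠ y → (∀ u' ∈ L, G.Adj u u' → u' ≠ z ∧ u' ≠ w) →
          G.Adj v u := by
        intro u hu hux huy hn
        rcases hnear u hu with h | ⟨u', hu', huu', -⟩
        · exact h
        · have := hfar u hu hux huy u' hu' huu'
          have := hn u' hu' huu'
          have := hcase u' hu'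
          tauto
      have hvz := hiso z hz hzn.1 hzn.2 fun u' _ h =>
        ⟨h.ne', by rintro rfl; exact hzwE h⟩
      have hvw := hiso w hw hwn.1 hwn.2 fun u' _ h =>
        ⟨by rintro rfl; exact hzwE h.symm, h.ne'⟩
      exact ⟨_, 2, h1, h2, hvx, hvz, by simpa using hxy, by simpa using hvw⟩
  · push Not at hE
    have hall : ∀ u ∈ L, G.Adj v u := fun u hu => by
      rcases hnear u hu with h | ⟨u', hu', h, -⟩
      · exact h
      · exact absurd h (hE u hu u' hu')
    let e := L.equivFin
    have hc := fun j : Fin 4 => (e.symm (Fin.cast hL.symm j)).2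
    refine ⟨fun j => (e.symm (Fin.cast hL.symm j)).1, 1, fun i j h => ?_, hc, hall _ (hc 0),
      hall _ (hc 2), by simpa using hall _ (hc 1), by simpa using hall _ (hc 3)⟩
    simpa using h

/-- As the other coordinates are free, any edge from another path to a vertex that is neither on
that path nor `v` could be completed to a path missed by some choice. So every other path is
attached only to `v`, as a `P_4` or a claw. -/
theorem IsPathFamily.nonempty_iso_starTree_of_forced {V ι : Type*} [Fintype V] [Fintype ι]
    [DecidableEq V] {G : SimpleGraph V} {q : ι → Fin 3 → V} (hG : G.IsTree)
    (hq : IsPathFamily G q) {k : ℕ} (hcard : Fintype.card V = 3 * k + 5)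
    (hι : Fintype.card ι = k + 1) {i₀ : ι} {s : Fin 3}
    (hs : ∀ x : ι → Fin 3, x i₀ = s → x ∈ coveringChoices G q) :
    ∃ (t : Fin 3) (b : Fin k → Bool), Nonempty (G ≃g starTree t b) := by
  classical
  set v := q i₀ s with hvdef
  have hout : ∀ i, i ≠ i₀ → ∀ j y, G.Adj (q i j) y → y = v ∨ ∃ j', y = q i j' := by
    intro i hi j y hy
    by_contra! hcon
    have key : ∀ j : Fin 3, ∃ l k : Fin 3, k ≠ j ∧ (k = 1 ∨ j = 1) ∧ l ≠ j ∧ l ≠ k := by decide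
    obtain ⟨l, k, hk, hjk, hlj, hlk⟩ := key j
    -- The missed path is `q i k`, `q i j`, `y`: path `i` uses its third vertex `l`, path `i₀` uses
    -- `v`, and every other path uses a vertex different from `y`.
    let x : ι → Fin 3 := fun i' => if i' = i then l else if i' = i₀ then s else
      if q i' 0 = y then 1 else 0
    have hx := mem_coveringChoices.1 (hs x (by simp [x, hi.symm]))
    have hxi : x i = l := by simp [x]
    have := hx _ _ _ (hq.adj i hk hjk) hy (hcon.2 k).symm
    rw [hq.mem_transversal, hq.mem_transversal, hxi] at this
    have hyx := (this.resolve_left hlk).resolve_left hlj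
    obtain ⟨i', -, h'⟩ := Finset.mem_image.1 hyx
    by_cases h1 : i' = i
    · exact hcon.2 _ (h1 ▸ h'.symm)
    by_cases h2 : i' = i₀
    · subst h2
      exact hcon.1 (by rw [← h']; simp [x, h1, hvdef])
    by_cases h3 : q i' 0 = y
    · simp only [x, h1, h2, h3, if_true, if_false] at h'
      exact hq.ne (i := i') (j := 0) (j' := 1) (by decide) (h3.trans h'.symm)
    · simp only [x, h1, h2, h3, if_false] at h'
  let R : Finset V := Finset.univ.image fun y : {i // i ≠ i₀} × Fin 3 => q y.1.1 y.2
  have hR : ∀ y, y ∈ R ↔ ∃ i, i ≠ i₀ ∧ ∃ j, q i j = y := fun y => by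
    simp [R]
  have hιk : Fintype.card {i // i ≠ i₀} = k := by
    rw [Fintype.card_subtype_compl, hι]; simp
  have hRcard : R.card = 3 * k := by
    rw [Finset.card_image_of_injective _ fun a b h => Prod.ext (Subtype.ext (hq.inj _ _ _ _ h).1)
      (hq.inj _ _ _ _ h).2]
    simp [hιk, mul_comm, -ne_eq]
  have hvR : v ∉ R := by
    rw [hR]
    rintro ⟨i, hi, j, h⟩
    exact hi (hq.inj _ _ _ _ h).1
  -- The four vertices are the other two of path `i₀` and the two outside all paths.
  have hL4 : (insert v R)ᶜ.card = 4 := by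
    rw [Finset.card_compl, Finset.card_insert_of_notMem hvR, hRcard, hcard]
    omega
  have hmemL : ∀ y, y ∈ (insert v R)ᶜ ↔ y ≠ v ∧ y ∉ R := fun y => by simp
  obtain ⟨c, t, hcinj, hcL, h0, h2, h1, h3⟩ := hG.1.exists_central_shape (v := v) hL4 (by simp)
    (fun y hy z hyz => by
      rw [hmemL] at hy ⊢
      by_cases hz : z = v
      · exact Or.inl hz
      · refine Or.inr ⟨hz, fun hzR => ?_⟩
        obtain ⟨i, hi, j, rfl⟩ := (hR z).1 hzR
        rcases hout i hi j y hyz.symm with rfl | ⟨j', rfl⟩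
        · exact hy.1 rfl
        · exact hy.2 ((hR _).2 ⟨i, hi, j', rfl⟩))
    (fun a ha b hb c hc hab hbc => by
      by_contra hac
      -- Any choice with value `s` at `i₀` misses these four vertices, so they contain no
      -- three-vertex path.
      have hx := mem_coveringChoices.1 (hs (fun _ => s) rfl)
      have hn : ∀ y, y ∈ (insert v R)ᶜ → y ∉ transversal q fun _ => s := by
        intro y hy hyt
        rw [hmemL] at hy
        obtain ⟨i, -, rfl⟩ := Finset.mem_image.1 hyt
        by_cases hi : i = i₀
        · exact hy.1 (by rw [hi])
        · exact hy.2 ((hR _).2 ⟨i, hi, s, rfl⟩)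
      have := hx a b c hab hbc hac
      have := hn a ha
      have := hn b hb
      have := hn c hc
      tauto)
  have hatt : ∀ i, i ≠ i₀ → ∃ (σ : Fin 3 → Fin 3) (b : Bool), σ.Injective ∧
      IsAttached G v (fun j => q i (σ j)) b := by
    intro i hi
    obtain ⟨x, ⟨j, rfl⟩, y, hy, hxy⟩ := hG.1.exists_adj_mem_notMem (Set.range (q i)) ⟨0, rfl⟩
      (b := v) (by
        rintro ⟨j, h⟩
        exact hi (hq.inj _ _ _ _ h).1)
    obtain rfl : y = v := by
      rcases hout i hi j y hxy with h | ⟨j', h⟩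
      · exact h
      · exact absurd ⟨j', h.symm⟩ hy
    fin_cases j
    · exact ⟨id, true, Function.injective_id, hq.adj01 i, hq.adj12 i, hxy.symm⟩
    · exact ⟨id, false, Function.injective_id, hq.adj01 i, hq.adj12 i, hxy.symm⟩
    · exact ⟨Fin.rev, true, Fin.rev_injective, (hq.adj12 i).symm, (hq.adj01 i).symm, hxy.symm⟩
  choose σ b hσ hab using hatt
  let e : Fin k ≃ {i // i ≠ i₀} := (Fintype.equivFinOfCardEq hιk).symm
  refine ⟨t, fun i => b (e i).1 (e i).2, hG.nonempty_iso_starTree hcard v c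
    (fun i j => q (e i).1 (σ (e i).1 (e i).2 j)) t _ ?_ h0 h2 h1 h3 fun i => hab _ _⟩
  have haR : ∀ i j, q (e i).1 (σ (e i).1 (e i).2 j) ∈ R := fun i j =>
    (hR _).2 ⟨_, (e i).2, _, rfl⟩
  rintro (_ | j | ⟨i, j⟩) (_ | j' | ⟨i', j'⟩) h <;> simp only [Option.elim, Sum.elim_inl,
    Sum.elim_inr] at h
  · rfl
  · exact absurd h.symm ((hmemL _).1 (hcL j')).1
  · exact absurd (h ▸ haR i' j') hvR
  · exact absurd h ((hmemL _).1 (hcL j)).1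
  · rw [hcinj h]
  · exact absurd (h ▸ haR i' j') ((hmemL _).1 (hcL j)).2
  · exact absurd (h ▸ haR i j) hvR
  · exact absurd (h ▸ haR i j) ((hmemL _).1 (hcL j')).2
  · obtain ⟨h1, h2⟩ := hq.inj _ _ _ _ h
    obtain rfl := e.injective (Subtype.ext h1)
    rw [hσ _ _ h2]

/-! ### The tree `LT8` -/

/-- The parent function of `LT8` rooted at the vertex `0`. -/
def lt8Parent : Fin 8 → Fin 8 := ![0, 0, 1, 2, 0, 1, 2, 3]

theorem lt8_eq : LT8 = parentGraph lt8Parent := by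
  have h : ∀ a b : Fin 8, (s(a, b) ∈ ({s(0, 1), s(1, 2), s(2, 3), s(0, 4), s(1, 5), s(2, 6),
      s(3, 7)} : Finset (Sym2 (Fin 8))) ∧ a ≠ b) ↔
      (a ≠ b ∧ (lt8Parent a = b ∨ lt8Parent b = a)) := by decide
  ext a b
  rw [parentGraph_adj, ← h, LT8, SimpleGraph.fromEdgeSet_adj]
  simp

theorem numMaximumDissociationSets_lt8 : numMaximumDissociationSets LT8 = 3 := by
  -- The paths `v₁ u₁ u₂` and `u₃ u₄ v₄` leave out `v₂` and `v₃`. The three minimum covers are `{u₂,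
  -- u₄}`, `{u₂, u₃}` and `{u₁, u₃}`.
  let q : Fin 2 → Fin 3 → Fin 8 := ![![4, 0, 1], ![2, 3, 7]]
  have hq : IsPathFamily LT8 q := by
    rw [lt8_eq]
    refine ⟨by decide, ?_, ?_⟩ <;> simp only [parentGraph_adj] <;> decide
  have hcov : ∀ x, IsPathCover LT8 (transversal q x) ↔
      (x 0, x 1) ∈ ({(2, 1), (2, 0), (1, 0)} : Finset (Fin 3 × Fin 3)) := by
    have key : ∀ y z : Fin 3, (∀ b a c : Fin 8, (a ≠ b ∧ (lt8Parent a = b ∨ lt8Parent b = a)) →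
        (b ≠ c ∧ (lt8Parent b = c ∨ lt8Parent c = b)) → a ≠ c →
        a ∈ ({q 0 y, q 1 z} : Finset (Fin 8)) ∨ b ∈ ({q 0 y, q 1 z} : Finset (Fin 8)) ∨
          c ∈ ({q 0 y, q 1 z} : Finset (Fin 8))) ↔
        (y, z) ∈ ({(2, 1), (2, 0), (1, 0)} : Finset (Fin 3 × Fin 3)) := by decide
    intro x
    rw [← key, show transversal q x = {q 0 (x 0), q 1 (x 1)} by
      ext; simp [transversal, Fin.exists_fin_two, eq_comm], lt8_eq]
    simp only [IsPathCover, parentGraph_adj]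
    exact forall_comm
  rw [hq.numMaximumDissociationSets_eq
    ⟨_, (hcov ![2, 1]).2 (by decide), hq.card_transversal _⟩]
  refine Eq.trans ?_ (show (({(2, 1), (2, 0), (1, 0)} : Finset (Fin 3 × Fin 3)).card = 3) by decide)
  refine Finset.card_nbij' (fun x => (x 0, x 1)) (fun y => ![y.1, y.2]) ?_ ?_ ?_ ?_
  · intro x hx
    exact (hcov x).1 (mem_coveringChoices.1 hx)
  · intro y hy
    exact mem_coveringChoices.2 ((hcov _).2 (by simpa using hy))
  · intro x _
    funext i
    fin_cases i <;> rfl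
  · intro y _
    rfl

/-- One half of `LT8`: the path on four vertices formed by a path of the family and the vertex `w`
attached to one of its ends, numbered from an inner vertex `q i p`. -/
theorem IsPathFamily.exists_path_four {V ι : Type*} {G : SimpleGraph V} {q : ι → Fin 3 → V}
    (hq : IsPathFamily G q) {w : V} (hw : ∀ i j, q i j ≠ w) {i : ι} {j p : Fin 3}
    (h : G.Adj w (q i j)) (hj : j ≠ 1) (hp : p = 1 ∨ p = j) :
    ∃ c : Fin 4 → V, c.Injective ∧ (∀ l, c l = w ∨ ∃ j, c l = q i j) ∧ c 0 = q i p ∧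
      G.Adj (c 0) (c 1) ∧ G.Adj (c 0) (c 2) ∧ G.Adj (c 2) (c 3) := by
  obtain ⟨k, hkj, hk1⟩ : ∃ k : Fin 3, k ≠ j ∧ k ≠ 1 := by
    clear h hp; revert j; decide
  have h1 := hq.ne (i := i) hkj
  have h2 := hq.ne (i := i) hk1
  have h3 := hq.ne (i := i) hj
  have h4 := hw i j
  have h5 := hw i k
  have h6 := hw i 1
  have h7 := h4.symm
  have h8 := h5.symm
  have h9 := h6.symm
  clear hw
  have a1 := hq.adj i hj (Or.inr rfl)
  have a2 := hq.adj i hk1 (Or.inr rfl)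
  rcases hp with rfl | rfl
  · refine ⟨![q i 1, q i k, q i j, w], ?_, ?_, rfl, a2.symm, a1.symm, h.symm⟩
    · intro a b hab
      fin_cases a <;> fin_cases b <;> simp_all
    · intro l; fin_cases l <;> simp
  · refine ⟨![q i p, w, q i 1, q i k], ?_, ?_, rfl, h.symm, a1, a2.symm⟩
    · intro a b hab
      fin_cases a <;> fin_cases b <;> simp_all
    · intro l; fin_cases l <;> simp

theorem SimpleGraph.IsTree.nonempty_iso_lt8 {V : Type*} [Fintype V] {G : SimpleGraph V}
    (hG : G.IsTree) (hcard : Fintype.card V = 8) {c d : Fin 4 → V} (hc : c.Injective)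
    (hd : d.Injective) (hcd : ∀ l l', c l ≠ d l') (h : G.Adj (c 0) (d 0))
    (hc1 : G.Adj (c 0) (c 1)) (hc2 : G.Adj (c 0) (c 2)) (hc3 : G.Adj (c 2) (c 3))
    (hd1 : G.Adj (d 0) (d 1)) (hd2 : G.Adj (d 0) (d 2)) (hd3 : G.Adj (d 2) (d 3)) :
    Nonempty (G ≃g LT8) := by
  rw [lt8_eq]
  refine hG.nonempty_iso_parentGraph 0 rfl (fun x => ⟨4, by revert x; decide⟩)
    -- The spine is `c 2, c 0, d 0, d 2`; the pendant vertices follow in the same order.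
    (f := ![c 2, c 0, d 0, d 2, c 3, c 1, d 1, d 3]) ?_ (by simpa using hcard) ?_
  · have : (![c 2, c 0, d 0, d 2, c 3, c 1, d 1, d 3] : Fin 8 → V) = Sum.elim c d ∘
        ![Sum.inl 2, Sum.inl 0, Sum.inr 0, Sum.inr 2, Sum.inl 3, Sum.inl 1, Sum.inr 1,
          Sum.inr 3] := by
      funext i
      fin_cases i <;> rfl
    rw [this]
    exact (hc.sumElim hd hcd).comp (by decide)
  · intro x hx
    fin_cases x
    · exact absurd rfl hx
    · exact hc2
    · exact h.symm
    · exact hd2.symm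
    · exact hc3.symm
    · exact hc1.symm
    · exact hd1.symm
    · exact hd3.symm

/-! ### The main count and the theorem -/

/-- The main count: a tree on `3 m + 2` vertices with `m` disjoint paths. -/
theorem IsPathFamily.card_coveringChoices_le {V ι : Type*} [Fintype V] [Fintype ι]
    [DecidableEq V] {G : SimpleGraph V} {q : ι → Fin 3 → V} (hG : G.IsTree)
    (hq : IsPathFamily G q) {k : ℕ} (hcard : Fintype.card V = 3 * k + 5)
    (hι : Fintype.card ι = k + 1) :
    (coveringChoices G q).card ≤ 3 ^ k ∧ ((coveringChoices G q).card = 3 ^ k →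
      (k = 1 ∧ Nonempty (G ≃g LT8)) ∨
        ∃ (t : Fin 3) (b : Fin k → Bool), Nonempty (G ≃g starTree t b)) := by
  classical
  have hk : Fintype.card ι - 1 = k := by omega
  by_cases hforced : ∃ i s, ∀ x ∈ coveringChoices G q, x i = s
  · obtain ⟨i, s, hs⟩ := hforced
    have h1 := card_choices_le_one (S := coveringChoices G q) i {s} (by simpa using hs)
    rw [hk, Finset.card_singleton, one_mul] at h1
    refine ⟨h1, fun heq => Or.inr ?_⟩
    exact hq.nonempty_iso_starTree_of_forced hG hcard hι (i₀ := i) (s := s) fun x hx =>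
      mem_of_card_choices_eq hs (by rw [hk, heq]) hx
  -- From here on no coordinate is constant, which excludes every position of `w₁` and `w₂` that
  -- would force one.
  have hnf : ∀ i s, (∀ x ∈ coveringChoices G q, x i = s) → False := fun i s h => hforced ⟨i, s, h⟩
  have hι0 : 0 < Fintype.card ι := by omega
  obtain ⟨i₀⟩ : Nonempty ι := Fintype.card_pos_iff.1 hι0
  obtain ⟨w₁, w₂, hne, hw⟩ : ∃ w₁ w₂, w₁ ≠ w₂ ∧
      (Finset.univ.image fun y : ι × Fin 3 => q y.1 y.2)ᶜ = {w₁, w₂} := by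
    rw [← Finset.card_eq_two, Finset.card_compl, hq.card_range, hcard, hι]
    omega
  have hmem : ∀ y, (y = w₁ ∨ y = w₂) ↔ ∀ i j, q i j ≠ y := fun y => by
    have := Finset.ext_iff.1 hw y
    simpa [eq_comm] using this.symm
  have hw₁ := (hmem w₁).1 (Or.inl rfl)
  have hw₂ := (hmem w₂).1 (Or.inr rfl)
  have hcov : ∀ y, y ≠ w₁ → y ≠ w₂ → ∃ i j, q i j = y := fun y h1 h2 => by
    by_contra! h
    exact ((hmem y).2 h).elim h1 h2
  have hnadj : ¬ G.Adj w₁ w₂ := by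
    intro h
    obtain ⟨x, hx, y, hy, hxy⟩ := hG.1.exists_adj_mem_notMem {w₁, w₂} (Or.inl rfl) (b := q i₀ 0)
      (by simp [hw₁, hw₂])
    simp only [Set.mem_insert_iff, Set.mem_singleton_iff, not_or] at hx hy
    obtain ⟨i, j, rfl⟩ := hcov y hy.1 hy.2
    rcases hx with rfl | rfl
    · exact hnf i j fun z hz => hq.eq_of_adj_uncovered_adj hz hw₁ hw₂ h.symm hxy
    · exact hnf i j fun z hz => hq.eq_of_adj_uncovered_adj hz hw₂ hw₁ h hxy
  have hatt : ∀ w w', (∀ i j, q i j ≠ w) → (∀ y, y ≠ w → y ≠ w' → ∃ i j, q i j = y) →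
      ¬ G.Adj w w' → ∃ i j, G.Adj w (q i j) := by
    intro w w' hw hcov hn
    obtain ⟨x, rfl, y, hy, hxy⟩ := hG.1.exists_adj_mem_notMem {w} rfl (b := q i₀ 0) (by simp [hw])
    obtain ⟨i, j, rfl⟩ := hcov y hy (by rintro rfl; exact hn hxy)
    exact ⟨i, j, hxy⟩
  obtain ⟨i₁, j₁, ha₁⟩ := hatt w₁ w₂ hw₁ hcov hnadj
  obtain ⟨i₂, j₂, ha₂⟩ := hatt w₂ w₁ hw₂ (fun y h1 h2 => hcov y h2 h1) fun h => hnadj h.symm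
  have hcen : ∀ w, (∀ i j, q i j ≠ w) → ∀ i j, G.Adj w (q i j) → j ≠ 1 := by
    rintro w hw i j h rfl
    refine hnf i 1 fun x hx => ?_
    have := hq.eq_or_of_adj_uncovered hx hw h
    tauto
  -- On a common path, a shared end would be forced, and distinct ends would leave only the middle.
  have hsep : ∀ i j j', G.Adj w₁ (q i j) → G.Adj w₂ (q i j') → False := by
    intro i j j' h h'
    by_cases hjj : j = j'
    · subst hjj
      exact hnf i j fun x hx => hq.eq_of_adj_uncovered_pair hx hw₁ hw₂ hne h h'
    · refine hnf i 1 fun x hx => ?_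
      have h1 := hq.eq_or_of_adj_uncovered hx hw₁ h
      have h2 := hq.eq_or_of_adj_uncovered hx hw₂ h'
      by_contra hx1
      exact hjj ((h1.resolve_left hx1).2.symm.trans (h2.resolve_left hx1).2)
  have hj₁ := hcen w₁ hw₁ _ _ ha₁
  have hj₂ := hcen w₂ hw₂ _ _ ha₂
  have hi : i₁ ≠ i₂ := by
    rintro rfl
    exact hsep _ _ _ ha₁ ha₂
  have hx₁ : ∀ x ∈ coveringChoices G q, x i₁ = 1 ∨ x i₁ = j₁ := fun x hx =>
    (hq.eq_or_of_adj_uncovered hx hw₁ ha₁).imp_right And.right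
  have hx₂ : ∀ x ∈ coveringChoices G q, x i₂ = 1 ∨ x i₂ = j₂ := fun x hx =>
    (hq.eq_or_of_adj_uncovered hx hw₂ ha₂).imp_right And.right
  by_cases hthird : ∃ l, i₁ ≠ l ∧ i₂ ≠ l ∧
      (((∃ p, G.Adj w₁ (q l p)) ∨ ∃ p p', G.Adj (q i₁ p) (q l p')) ∨
        ((∃ p, G.Adj w₂ (q l p)) ∨ ∃ p p', G.Adj (q i₂ p) (q l p')))
  · obtain ⟨l, hl₁, hl₂, h | h⟩ := hthird
    · have := hq.card_coveringChoices_lt hw₁ hi hl₁ hl₂ ha₁ hj₁ hx₂ h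
      rw [hk] at this
      exact ⟨this.le, fun h => absurd h this.ne⟩
    · have := hq.card_coveringChoices_lt hw₂ hi.symm hl₂ hl₁ ha₂ hj₂ hx₁ h
      rw [hk] at this
      exact ⟨this.le, fun h => absurd h this.ne⟩
  -- A further path would give an edge leaving `w₁`, `w₂` and their two paths, which leads to a
  -- third path as in `hthird`.
  have hall : ∀ i, i = i₁ ∨ i = i₂ := by
    intro i
    by_contra! hcon
    obtain ⟨x, hx, y, hy, hxy⟩ := hG.1.exists_adj_mem_notMem
      {y | y = w₁ ∨ y = w₂ ∨ ∃ j, y = q i₁ j ∨ y = q i₂ j} (Or.inl rfl) (b := q i 0) (by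
        rintro (h | h | ⟨j, h | h⟩)
        · exact hw₁ _ _ h
        · exact hw₂ _ _ h
        · exact hq.ne_of_ne hcon.1 h
        · exact hq.ne_of_ne hcon.2 h)
    simp only [Set.mem_ofPred_eq, not_or, not_exists] at hx hy
    obtain ⟨l, p, rfl⟩ := hcov y hy.1 hy.2.1
    refine hthird ⟨l, ?_, ?_, ?_⟩
    · rintro rfl; exact (hy.2.2 p).1 rfl
    · rintro rfl; exact (hy.2.2 p).2 rfl
    · rcases hx with rfl | rfl | ⟨j, rfl | rfl⟩
      · exact Or.inl (Or.inl ⟨p, hxy⟩)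
      · exact Or.inr (Or.inl ⟨p, hxy⟩)
      · exact Or.inl (Or.inr ⟨j, p, hxy⟩)
      · exact Or.inr (Or.inr ⟨j, p, hxy⟩)
  have hι2 : Fintype.card ι = 2 := by
    rw [← Finset.card_univ, Finset.card_eq_two]
    exact ⟨i₁, i₂, hi, by ext i; simpa using hall i⟩
  obtain rfl : k = 1 := by omega
  obtain ⟨p, p', hpp⟩ : ∃ p p', G.Adj (q i₁ p) (q i₂ p') := by
    obtain ⟨x, hx, y, hy, hxy⟩ := hG.1.exists_adj_mem_notMem
      {y | y = w₁ ∨ ∃ j, y = q i₁ j} (Or.inl rfl) (b := w₂) (by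
        rintro (h | ⟨j, h⟩)
        · exact hne h.symm
        · exact hw₂ _ _ h.symm)
    simp only [Set.mem_ofPred_eq, not_or, not_exists] at hx hy
    by_cases hyw : y = w₂
    · subst hyw
      rcases hx with rfl | ⟨j, rfl⟩
      · exact absurd hxy hnadj
      · exact absurd ha₁ fun h => hsep _ _ _ h hxy.symm
    · obtain ⟨l, p', rfl⟩ := hcov y hy.1 hyw
      obtain rfl : l = i₂ := (hall l).resolve_left (by rintro rfl; exact hy.2 p' rfl)
      rcases hx with rfl | ⟨j, rfl⟩
      · exact absurd ha₂ fun h => hsep _ _ _ hxy h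
      · exact ⟨j, p', hxy⟩
  -- Of the four pairs in `{1, j₁} × {1, j₂}`, the joining edge rules out the one avoiding both its
  -- ends. If an end is not among these values, at least two pairs are lost, so three survive only
  -- when `p` and `p'` are both among them.
  obtain ⟨A, hA3, hA, hmemA⟩ : ∃ A : Finset (Fin 3 × Fin 3), A.card ≤ 3 ∧
      (A.card = 3 → (p = 1 ∨ p = j₁) ∧ (p' = 1 ∨ p' = j₂)) ∧
      ∀ x ∈ coveringChoices G q, (x i₁, x i₂) ∈ A := by
    refine ⟨Finset.univ.filter fun a => (a.1 = 1 ∨ a.1 = j₁) ∧ (a.2 = 1 ∨ a.2 = j₂) ∧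
        (a.1 = (if p = j₁ then j₁ else 1) ∨ a.2 = p') ∧
        (a.2 = (if p' = j₂ then j₂ else 1) ∨ a.1 = p), ?_, ?_, fun x hx => ?_⟩
    · clear hx₁ hx₂ hpp ha₁ ha₂
      revert j₁ j₂ p p'
      decide
    · clear hx₁ hx₂ hpp ha₁ ha₂
      revert j₁ j₂ p p'
      decide
    · have h1 := hq.eq_or_of_adj hx hw₁ hi ha₁ hj₁ hpp
      have h2 := hq.eq_or_of_adj hx hw₂ hi.symm ha₂ hj₂ hpp.symm
      exact Finset.mem_filter.2 ⟨Finset.mem_univ _, hx₁ x hx, hx₂ x hx, h1, h2⟩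
  have hle := card_choices_le_two hi A hmemA
  rw [hι2] at hle
  refine ⟨by simpa using hle.trans (by simpa using hA3), fun heq => Or.inl ⟨rfl, ?_⟩⟩
  obtain ⟨hp, hp'⟩ := hA (le_antisymm hA3 (by simpa [heq] using hle))
  obtain ⟨c, hc, hcm, hc0, hc1, hc2, hc3⟩ := hq.exists_path_four hw₁ ha₁ hj₁ hp
  obtain ⟨d, hd, hdm, hd0, hd1, hd2, hd3⟩ := hq.exists_path_four hw₂ ha₂ hj₂ hp'
  refine hG.nonempty_iso_lt8 (by simpa using hcard) hc hd ?_ (by rwa [hc0, hd0]) hc1 hc2 hc3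
    hd1 hd2 hd3
  intro l l' h
  rcases hcm l with h1 | ⟨j, h1⟩ <;> rcases hdm l' with h2 | ⟨j', h2⟩ <;> rw [h1, h2] at h
  · exact hne h
  · exact hw₁ _ _ h.symm
  · exact hw₂ _ _ h
  · exact hq.ne_of_ne hi h

theorem SimpleGraph.IsTree.numMaximumDissociationSets_le {V : Type*} [Fintype V]
    {G : SimpleGraph V} (hG : G.IsTree) {k : ℕ} (hcard : Fintype.card V = 3 * k + 5) :
    numMaximumDissociationSets G ≤ 3 ^ k ∧ (numMaximumDissociationSets G = 3 ^ k →
      (k = 1 ∧ Nonempty (G ≃g LT8)) ∨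
        ∃ (t : Fin 3) (b : Fin k → Bool), Nonempty (G ≃g starTree t b)) := by
  classical
  obtain ⟨t, C, q, hC, hCt, hq⟩ := hG.exists_cover_eq_packing
  rw [hq.numMaximumDissociationSets_eq ⟨C, hC, by simpa using hCt⟩]
  -- Disjointness gives `3 * t ≤ 3 * k + 5`, hence `t ≤ k + 1`.
  have hr := (Finset.card_le_univ _).trans' hq.card_range.ge
  rw [Fintype.card_fin] at hr
  rcases (show t < k + 1 ∨ t = k + 1 by omega) with ht | rfl
  · have := hq.card_coveringChoices_lt_of_card_lt hG.1 (m := k + 1) (by omega) (by simpa using ht)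
    simp only [Nat.add_sub_cancel] at this
    exact ⟨this.le, fun h => absurd h this.ne⟩
  · exact hq.card_coveringChoices_le hG hcard (by simp)

theorem theorem4p4 (m : ℕ) (hm : 1 ≤ m) :
    (∀ (V : Type*) [Fintype V] (G : SimpleGraph V), G.IsTree → Fintype.card V = 3 * m + 2 →
      numMaximumDissociationSets G ≤ 3 ^ (m - 1) ∧
      (m = 2 →
        (numMaximumDissociationSets G = 3 ^ (m - 1) ↔
          Nonempty (G ≃g LT8) ∨ InExtremalSStarFamilies G (m - 1))) ∧
      (m ≠ 2 →
        (numMaximumDissociationSets G = 3 ^ (m - 1) ↔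
          InExtremalSStarFamilies G (m - 1)))) ∧
    (∃ G : SimpleGraph (Fin (3 * m + 2)), G.IsTree ∧
      numMaximumDissociationSets G = 3 ^ (m - 1)) := by
  -- With `k = m - 1` the order is `3 * k + 5` and the bound `3 ^ k`.
  obtain ⟨k, rfl⟩ : ∃ k, m = k + 1 := ⟨m - 1, by omega⟩
  simp only [Nat.add_sub_cancel]
  refine ⟨fun V _ G hG hcard => ?_, ?_⟩
  · have hcard' : Fintype.card V = 3 * k + 5 := by omega
    obtain ⟨hle, heq⟩ := hG.numMaximumDissociationSets_le hcard'
    have hstar : InExtremalSStarFamilies G k → numMaximumDissociationSets G = 3 ^ k := fun h => by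
      obtain ⟨t, b, ⟨φ⟩⟩ := h.nonempty_iso_starTree hG hcard'
      rw [numMaximumDissociationSets_congr φ, numMaximumDissociationSets_starTree]
    refine ⟨hle, fun hm2 => ⟨fun h => ?_, ?_⟩, fun hm2 => ⟨fun h => ?_, hstar⟩⟩
    · rcases heq h with ⟨-, h⟩ | ⟨t, b, ⟨φ⟩⟩
      · exact Or.inl h
      · exact Or.inr ((starTree_inExtremalSStarFamilies t b).of_iso φ)
    · rintro (⟨⟨φ⟩⟩ | h)
      · obtain rfl : k = 1 := by omega
        rw [numMaximumDissociationSets_congr φ, numMaximumDissociationSets_lt8, pow_one]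
      · exact hstar h
    · rcases heq h with ⟨rfl, -⟩ | ⟨t, b, ⟨φ⟩⟩
      · exact absurd rfl hm2
      · exact (starTree_inExtremalSStarFamilies t b).of_iso φ
  · let e : StarVertex k ≃ Fin (3 * (k + 1) + 2) :=
      Fintype.equivFinOfCardEq (by rw [card_starVertex]; ring)
    let φ := SimpleGraph.Iso.map e (starTree (k := k) 0 fun _ => true)
    refine ⟨_, φ.isTree_iff.1 (starTree_isTree _ _), ?_⟩
    rw [← numMaximumDissociationSets_congr φ, numMaximumDissociationSets_starTree]
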